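/- Let $d\ge 2$ and $N\ge 2$ be integers. Consider $N$ identical spinless particles of unit mass in $\mathbb{R}^d$ at positions $r_0,\dots,r_{N-1}$, with pair potential $-1/r$, and remove the centre of mass. In the relative coordinates $x_i=r_i-r_0\in\mathbb{R}^d$ ($1\le i\le N-1$), the reduced Hamiltonian is $$H=-\frac12\sum_{i=1}^{N-1}\Delta_{x_i}-\frac12\sum_{i,j=1}^{N-1}\nabla_{x_i}\cdot\nabla_{x_j}-\sum_{0\le i<j\le N-1}\frac{1}{r_{ij}},\qquad r_{ij}=\|r_j-r_i\|,$$ that is, $-\frac12\sum_{i=0}^{N-1}\Delta_{r_i}-\sum_{i<j}1/r_{ij}$ restricted to functions of the relative coordinates. It acts in $L^2(\mathbb{R}^{(N-1)d};\mathbb{C})$ (Lebesgue measure), in the sense of distributions, with domain $\{\psi\in H^1(\mathbb{R}^{(N-1)d}) : H\psi\in L^2\}$ (where the product of $\psi$ with the potential is required to be locally integrable). Let $\sigma(H)\cap\mathbb{R}$ be the set of real $E$ for which $H-E$ is not a bijection from the domain of $H$ onto $L^2$ with bounded inverse, and put $$B=-\frac{1}{(d-1)^2}\,\frac{N(N-1)(N+1)}{6}.$$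 Then the lowest energy $e_0$ satisfies $e_0\le B$. Precisely: (i) $H$ has a point $E\in\sigma(H)\cap\mathbb{R}$ with $E\le B$; (ii) if $e_0$ is the infimum of $\sigma(H)\cap\mathbb{R}$, then $e_0\le B$ (in particular, if the bottom of the spectrum is an eigenvalue, this eigenvalue is at most $B$); (iii) if $e_0\in\mathbb{R}$ is an eigenvalue of $H$ with a non-zero real eigenfunction that is non-negative almost everywhere, then $e_0\le B$. -/

import Mathlib

open MeasureTheory
open scoped ContDiff

namespace ManyBody

/-- The relative configuration space `ℝ^{(N-1)d}` of `N = n + 1` particles in `ℝ^d`: a point is the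
tuple of the vectors `x i = r_{i+1} - r_0`, for `i = 0, …, n - 1`. Its volume is Lebesgue measure. -/
abbrev Config (d n : ℕ) : Type := PiLp 2 (fun _ : Fin n => EuclideanSpace ℝ (Fin d))

/-- The Hilbert space `L²(ℝ^{(N-1)d})` of complex square-integrable functions, `N = n + 1`. -/
abbrev State (d n : ℕ) : Type := Lp ℂ 2 (volume : Measure (Config d n))

/-- The relative coordinates `(r_1 - r_0, …, r_n - r_0)` of the particles at `r_0, …, r_n`. -/
def rel {d n : ℕ} (r : Fin (n + 1) → EuclideanSpace ℝ (Fin d)) : Config d n :=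
  WithLp.toLp 2 (fun i => r i.succ - r 0)

/-- The positions of the particles with relative coordinates `x`, particle `0` at the origin. -/
def pos {d n : ℕ} (x : Config d n) : Fin (n + 1) → EuclideanSpace ℝ (Fin d) :=
  Fin.cons 0 (fun i => x i)

/-- The displacement of the relative coordinates when particle `i` moves by the `k`-th unit
vector. -/
noncomputable def dir {d n : ℕ} (i : Fin (n + 1)) (k : Fin d) : Config d n :=
  rel (Pi.single i (EuclideanSpace.single k 1))

/-- The kinetic energy `∑ᵢ -(1/2) Δᵢ` (unit masses) on smooth functions of the relative
coordinates: the value at `x` of `∑ᵢ -(1/2) Δᵢ (η ∘ rel)`, where `Δᵢ` is the sum over `k` of the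
second derivatives of `η ∘ rel` in the `k`-th coordinate of the `i`-th particle. -/
noncomputable def kinetic {d n : ℕ} (η : Config d n → ℝ) (x : Config d n) : ℝ :=
  ∑ i : Fin (n + 1), -(1 / 2 : ℝ) * ∑ k : Fin d,
    lineDeriv ℝ (fun y => lineDeriv ℝ η y (dir i k)) x (dir i k)

/-- The potential energy `∑_{i<j} -1/r_{ij}`. -/
noncomputable def potential {d n : ℕ} (x : Config d n) : ℝ :=
  ∑ i : Fin (n + 1), ∑ j ∈ Finset.Ioi i, -(1 / ‖pos x j - pos x i‖)

/-- `ψ` is in the Sobolev space `H¹`: it has square-integrable weak derivatives in all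
directions. -/
def MemH1 {d n : ℕ} (ψ : State d n) : Prop :=
  ∀ u : Config d n, ∃ g : State d n, ∀ η : Config d n → ℝ, ContDiff ℝ ∞ η → HasCompactSupport η →
    ∫ x, η x • g x = -∫ x, lineDeriv ℝ η x u • ψ x

/-- `ψ` is in the domain of the Hamiltonian and `f = Hψ`: `ψ ∈ H¹`, the product `Vψ` is locally
integrable, `f ∈ L²`, and `Tψ + Vψ = f` in the sense of distributions, where `T` is the kinetic
energy and `V` the potential. -/
def IsImage {d n : ℕ} (ψ f : State d n) : Prop :=
  MemH1 ψ ∧ LocallyIntegrable (fun x => potential x • ψ x) ∧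
    ∀ η : Config d n → ℝ, ContDiff ℝ ∞ η → HasCompactSupport η →
      ∫ x, η x • f x = (∫ x, kinetic η x • ψ x) + ∫ x, η x • (potential x • ψ x)

section Helpers

variable {d n : ℕ}

theorem locallyIntegrable_state (ψ : State d n) : LocallyIntegrable (fun x => ψ x) :=
  (Lp.memLp ψ).locallyIntegrable (by norm_num)

theorem contDiff_lineDeriv {η : Config d n → ℝ} (h : ContDiff ℝ ∞ η) (u : Config d n) :
    ContDiff ℝ ∞ (fun x => lineDeriv ℝ η x u) := by
  have h1 : (fun x => lineDeriv ℝ η x u) = fun x => fderiv ℝ η x u := by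
    funext x
    exact ((h.differentiable (by simp)) x).lineDeriv_eq_fderiv
  rw [h1]
  exact (h.fderiv_right (m := ∞) (by simp)).clm_apply contDiff_const

theorem hasCompactSupport_lineDeriv {η : Config d n → ℝ} (h : ContDiff ℝ ∞ η)
    (hc : HasCompactSupport η) (u : Config d n) :
    HasCompactSupport (fun x => lineDeriv ℝ η x u) := by
  have h1 : (fun x => lineDeriv ℝ η x u) = fun x => fderiv ℝ η x u := by
    funext x
    exact ((h.differentiable (by simp)) x).lineDeriv_eq_fderiv
  rw [h1]
  exact hc.fderiv_apply (𝕜 := ℝ) u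

theorem continuous_kinetic {η : Config d n → ℝ} (h : ContDiff ℝ ∞ η) :
    Continuous (kinetic η) := by
  unfold kinetic
  refine continuous_finsetSum _ fun i _ => continuous_const.mul
    (continuous_finsetSum _ fun k _ => ?_)
  exact (contDiff_lineDeriv (contDiff_lineDeriv h _) _).continuous

theorem hasCompactSupport_kinetic {η : Config d n → ℝ}
    (hc : HasCompactSupport η) : HasCompactSupport (kinetic η) := by
  refine HasCompactSupport.of_support_subset_isCompact hc fun x hx => ?_
  by_contra hn
  apply hx
  have h0 : η =ᶠ[nhds x] 0 := notMem_tsupport_iff_eventuallyEq.mp hn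
  have key : ∀ {ζ : Config d n → ℝ}, ζ =ᶠ[nhds x] 0 → ∀ u : Config d n,
      (fun y => lineDeriv ℝ ζ y u) =ᶠ[nhds x] 0 := by
    intro ζ hζ u
    filter_upwards [eventually_eventually_nhds.mpr hζ] with y hy
    have := Filter.EventuallyEq.lineDeriv_eq (𝕜 := ℝ) (v := u) (f₁ := ζ)
      (f := fun _ => (0 : ℝ)) hy
    simpa [lineDeriv] using this
  unfold kinetic
  refine Finset.sum_eq_zero fun i _ => ?_
  rw [Finset.sum_eq_zero fun k _ => ?_, mul_zero]
  exact (key (key h0 (dir i k)) (dir i k)).self_of_nhds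

theorem integrable_test_smul {η : Config d n → ℝ} (h : Continuous η)
    (hc : HasCompactSupport η) {F : Config d n → ℂ} (hF : LocallyIntegrable F) :
    Integrable (fun x => η x • F x) :=
  hF.integrable_smul_left_of_hasCompactSupport h hc

end Helpers

/-- The graph of the Hamiltonian, as a subspace of `L² × L²`. -/
noncomputable def hamiltonianGraph (d n : ℕ) : Submodule ℂ (State d n × State d n) where
  carrier := {p | IsImage p.1 p.2}
  zero_mem' := by
    have h0 : ((0 : State d n) : Config d n → ℂ) =ᵐ[volume] 0 := Lp.coeFn_zero _ _ _
    have hz : ∀ c : Config d n → ℝ, ∫ x, c x • (0 : State d n) x = 0 := fun c =>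
      integral_eq_zero_of_ae (by filter_upwards [h0] with x hx; simp only [hx, Pi.zero_apply, smul_zero])
    refine ⟨fun u => ⟨0, fun η _ _ => ?_⟩, ?_, fun η _ _ => ?_⟩
    · simp only [Prod.fst_zero, hz, neg_zero]
    · refine (locallyIntegrable_zero (μ := volume) (X := Config d n) (ε'' := ℂ)).congr ?_
      filter_upwards [h0] with x hx
      simp only [Prod.fst_zero, hx, Pi.zero_apply, smul_zero]
    · simp only [Prod.fst_zero, Prod.snd_zero, smul_smul, hz, add_zero]
  add_mem' := by
    rintro ⟨ψ, f⟩ ⟨ψ', f'⟩ ⟨h1, h2, h3⟩ ⟨h1', h2', h3'⟩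
    have hadd : ∀ (a b : State d n) (c : Config d n → ℝ), Continuous c → HasCompactSupport c →
        ∫ x, c x • (a + b : State d n) x = (∫ x, c x • a x) + ∫ x, c x • b x := by
      intro a b c hc hs
      rw [← integral_add (integrable_test_smul hc hs (locallyIntegrable_state a))
        (integrable_test_smul hc hs (locallyIntegrable_state b))]
      refine integral_congr_ae ?_
      filter_upwards [Lp.coeFn_add a b] with x hx
      simp only [hx, Pi.add_apply, smul_add]
    have hV : (fun x => potential x • (ψ + ψ' : State d n) x) =ᵐ[volume]
        fun x => potential x • ψ x + potential x • ψ' x := by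
      filter_upwards [Lp.coeFn_add ψ ψ'] with x hx
      rw [hx, Pi.add_apply, smul_add]
    refine ⟨fun u => ?_, (h2.add h2').congr hV.symm, fun η hη hc => ?_⟩
    · obtain ⟨g, hg⟩ := h1 u
      obtain ⟨g', hg'⟩ := h1' u
      refine ⟨g + g', fun η hη hc => ?_⟩
      simp only [Prod.mk_add_mk]
      rw [hadd _ _ _ hη.continuous hc, hadd _ _ _ (contDiff_lineDeriv hη u).continuous
        (hasCompactSupport_lineDeriv hη hc u), hg η hη hc, hg' η hη hc]
      ring
    · simp only [Prod.mk_add_mk]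
      have hV' : ∫ x, η x • (potential x • (ψ + ψ' : State d n) x) =
          (∫ x, η x • (potential x • ψ x)) + ∫ x, η x • (potential x • ψ' x) := by
        rw [← integral_add (integrable_test_smul hη.continuous hc h2)
          (integrable_test_smul hη.continuous hc h2')]
        refine integral_congr_ae ?_
        filter_upwards [hV] with x hx
        rw [hx, smul_add]
      rw [hadd _ _ _ hη.continuous hc, hadd _ _ _ (continuous_kinetic hη)
        (hasCompactSupport_kinetic hc), hV', h3 η hη hc, h3' η hη hc]
      ring
  smul_mem' := by
    rintro a ⟨ψ, f⟩ ⟨h1, h2, h3⟩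
    have hsmul : ∀ (b : State d n) (c : Config d n → ℝ),
        ∫ x, c x • (a • b : State d n) x = a * ∫ x, c x • b x := by
      intro b c
      rw [← integral_const_mul]
      refine integral_congr_ae ?_
      filter_upwards [Lp.coeFn_smul a b] with x hx
      simp only [hx, Pi.smul_apply, smul_eq_mul, Complex.real_smul]
      ring
    refine ⟨fun u => ?_, (h2.smul a).congr ?_, fun η hη hc => ?_⟩
    · obtain ⟨g, hg⟩ := h1 u
      refine ⟨a • g, fun η hη hc => ?_⟩
      simp only [Prod.smul_mk]
      rw [hsmul, hsmul, hg η hη hc]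
      ring
    · filter_upwards [Lp.coeFn_smul a ψ] with x hx
      simp only [Prod.smul_mk, hx, Pi.smul_apply, smul_eq_mul, Complex.real_smul]
      ring
    · simp only [Prod.smul_mk, smul_smul]
      rw [hsmul, hsmul, hsmul, h3 η hη hc]
      simp only [smul_smul]
      ring

/-- The graph is single valued, so that it is the graph of the operator defined next. -/
theorem hamiltonianGraph_single_valued (d n : ℕ) (p : State d n × State d n)
    (hp : p ∈ hamiltonianGraph d n) (h0 : p.1 = 0) : p.2 = 0 := by
  obtain ⟨ψ, f⟩ := p
  obtain ⟨-, -, h⟩ := hp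
  simp only at h0 h ⊢
  subst h0
  have hz : ((0 : State d n) : Config d n → ℂ) =ᵐ[volume] 0 := Lp.coeFn_zero _ _ _
  have hz' : ∀ c : Config d n → ℝ, ∫ x, c x • (0 : State d n) x = 0 := fun c =>
    integral_eq_zero_of_ae (by filter_upwards [hz] with x hx; simp only [hx, Pi.zero_apply, smul_zero])
  have := ae_eq_zero_of_integral_contDiff_smul_eq_zero (locallyIntegrable_state f)
    (fun η hη hc => by rw [h η hη hc]; simp only [smul_smul, hz', add_zero])
  exact Lp.eq_zero_iff_ae_eq_zero.mpr this

/-- The Hamiltonian of `N = n + 1` identical spinless particles of unit mass in `ℝ^d` with pair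
potential `-1/r`, the centre of mass being removed: the unbounded operator on `L²(ℝ^{(N-1)d})` with
domain `{ψ ∈ H¹ : Tψ + Vψ ∈ L²}`, acting as `Tψ + Vψ` in the sense of distributions. -/
noncomputable def hamiltonian (d n : ℕ) : State d n →ₗ.[ℂ] State d n :=
  (hamiltonianGraph d n).toLinearPMap

theorem mem_graph_hamiltonian {d n : ℕ} (p : State d n × State d n) :
    p ∈ (hamiltonian d n).graph ↔ IsImage p.1 p.2 := by
  rw [hamiltonian, Submodule.toLinearPMap_graph_eq _ (hamiltonianGraph_single_valued d n)]
  rfl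

/-- `z` is in the resolvent set of the unbounded operator `A`: the operator `A - z` is a bijection
from the domain of `A` onto the whole space, with bounded inverse `R`. -/
def IsResolventPoint {E : Type*} [NormedAddCommGroup E] [NormedSpace ℂ E] (A : E →ₗ.[ℂ] E)
    (z : ℂ) : Prop :=
  ∃ R : E →L[ℂ] E, (∀ f : E, ∃ h : R f ∈ A.domain, A ⟨R f, h⟩ - z • R f = f) ∧
    ∀ ψ : A.domain, R (A ψ - z • (ψ : E)) = ψ

/-- The energies of `N = n + 1` particles: the (real) spectrum of the Hamiltonian. -/
def energySpectrum (d n : ℕ) : Set ℝ :=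
  {E | ¬ IsResolventPoint (hamiltonian d n) (E : ℂ)}

/-- `e` is an eigenvalue of the Hamiltonian with a non-zero real eigenfunction that is non-negative
almost everywhere. -/
def IsNonnegEigenvalue (d n : ℕ) (e : ℝ) : Prop :=
  ∃ Φ : (hamiltonian d n).domain, (Φ : State d n) ≠ 0 ∧
    (∀ᵐ x, 0 ≤ ((Φ : State d n) x).re ∧ ((Φ : State d n) x).im = 0) ∧
    hamiltonian d n Φ = (e : ℂ) • (Φ : State d n)

end ManyBody

/-!
Put `c = 1/(d - 1)` and `ψ = exp(-c ∑_{i<j} r_ij)`. As the Laplacian of a distance `r` in `ℝ^d` is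
`(d - 1)/r`, the singular part of `Tψ` cancels `Vψ`, and off the collisions `Hψ = Wψ` with the
bounded local energy `W = -(c²/2) ∑ₗ |Sₗ|²`, where `Sₗ` is the sum of the unit vectors from particle
`l` to the others. Expanding the squares gives a sum over triples of particles; its cyclic averages
are sums of cosines of the angles of triangles, which are at least `1`, so that `∑ₗ |Sₗ|²` is at
least `N (N² - 1)/3` and `W` is at most the bound of the theorem
(`le_sum_norm_sum_unit_sq`, `trialEnergy_le`).

That `ψ` is in the domain and `Hψ = Wψ` in the sense of distributions (`isRealImage_trial`) is shown
by replacing each distance `r` with `(r² + ε²)^{1/2}`, integrating by parts, and letting `ε` tend to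
`0`.

The Hamiltonian is symmetric (`IsRealImage.symm`, `IsImage.inner_eq`). Its defining equation extends
from test functions to `H¹`, because test functions are dense there (`exists_test_approx`) and the
potential is continuous as a quadratic form on `H¹`, by the weak Hardy inequality
`∫ f²/r ≤ 2 ∑ₖ ∫ |f| |∂ₖf|` (`lintegral_sq_div_norm_sep_le`), which holds from `d = 2` on.

As `⟪ψ, Hψ⟫` is at most the bound times `‖ψ‖²`, the variational principle
(`exists_le_not_isResolventPoint`) gives a point of the spectrum; it needs only that `H` is
symmetric. For a non-negative eigenfunction `Φ` of energy `e₀`, symmetry gives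
`∫ (e₀ - W) Φ ψ = 0` with `Φ ψ ≥ 0` not almost everywhere zero, which forces `e₀` to be at most the
bound (`IsNonnegEigenvalue.le`).
-/

namespace ManyBody

open Filter Topology
open scoped ENNReal Convolution

/-! ### Convergence in `L²` -/

section L2

variable {X : Type*} [MeasurableSpace X] {μ : Measure X}

theorem tendsto_eLpNorm_sub_of_dominated {F : ℕ → X → ℝ} {f G : X → ℝ}
    (hG : MemLp G 2 μ) (hF : ∀ k, AEStronglyMeasurable (F k) μ) (hf : AEStronglyMeasurable f μ)
    (hb : ∀ k x, |F k x - f x| ≤ G x)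
    (hlim : ∀ᵐ x ∂μ, Tendsto (fun k => F k x) atTop (𝓝 (f x))) :
    Tendsto (fun k => eLpNorm (fun x => F k x - f x) 2 μ) atTop (𝓝 0) := by
  have hsq : ∀ g : X → ℝ, eLpNorm g 2 μ = (∫⁻ x, ‖g x‖ₑ ^ (2 : ℝ) ∂μ) ^ (1 / (2 : ℝ)) := fun g => by
    rw [eLpNorm_eq_lintegral_rpow_enorm_toReal (by norm_num) (by norm_num)]; norm_num
  simp only [hsq]
  have h0 : Tendsto (fun k => ∫⁻ x, ‖F k x - f x‖ₑ ^ (2 : ℝ) ∂μ) atTop (𝓝 0) := by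
    rw [← lintegral_zero (μ := μ)]
    refine tendsto_lintegral_of_dominated_convergence' (fun x => ‖G x‖ₑ ^ (2 : ℝ))
      (fun k => (((hF k).sub hf).enorm).pow_const _) (fun k => ae_of_all _ fun x => ?_) ?_ ?_
    · refine ENNReal.rpow_le_rpow ?_ (by norm_num)
      exact enorm_le_iff_norm_le.mpr (by
        rw [Real.norm_eq_abs, Real.norm_eq_abs]; exact (hb k x).trans (le_abs_self _))
    · have := hG.eLpNorm_lt_top
      rw [hsq] at this
      exact ne_of_lt ((ENNReal.rpow_lt_top_iff_of_pos (by norm_num)).mp this)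
    · filter_upwards [hlim] with x hx
      have h1 : Tendsto (fun k => ‖F k x - f x‖ₑ) atTop (𝓝 0) := by
        have := (hx.sub_const (f x)).enorm
        simpa using this
      have := ((ENNReal.continuous_rpow_const (y := 2)).tendsto 0).comp h1
      simpa [Function.comp_def] using this
  have := ((ENNReal.continuous_rpow_const (y := 1 / (2 : ℝ))).tendsto 0).comp h0
  simpa [Function.comp_def] using this

theorem tendsto_integral_mul_of_tendsto_eLpNorm {F G : ℕ → X → ℝ} {f g : X → ℝ}
    (hF : ∀ k, MemLp (F k) 2 μ) (hf : MemLp f 2 μ) (hG : ∀ k, MemLp (G k) 2 μ) (hg : MemLp g 2 μ)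
    (hFf : Tendsto (fun k => eLpNorm (fun x => F k x - f x) 2 μ) atTop (𝓝 0))
    (hGg : Tendsto (fun k => eLpNorm (fun x => G k x - g x) 2 μ) atTop (𝓝 0)) :
    Tendsto (fun k => ∫ x, F k x * G k x ∂μ) atTop (𝓝 (∫ x, f x * g x ∂μ)) := by
  have h1 := (Lp.tendsto_Lp_iff_tendsto_eLpNorm'' F hF f hf).mpr hFf
  have h2 := (Lp.tendsto_Lp_iff_tendsto_eLpNorm'' G hG g hg).mpr hGg
  have key : ∀ {a b : X → ℝ} (ha : MemLp a 2 μ) (hb : MemLp b 2 μ),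
      inner ℝ (ha.toLp a) (hb.toLp b) = ∫ x, a x * b x ∂μ := by
    intro a b ha hb
    rw [L2.inner_def]
    refine integral_congr_ae ?_
    filter_upwards [ha.coeFn_toLp, hb.coeFn_toLp] with x hx hx'
    rw [hx, hx']
    simp [mul_comm]
  have := h1.inner (𝕜 := ℝ) h2
  rw [key] at this
  exact this.congr fun k => key _ _

theorem tendsto_eLpNorm_abs_sub {F : ℕ → X → ℝ} {f : X → ℝ}
    (h : Tendsto (fun k => eLpNorm (fun x => F k x - f x) 2 μ) atTop (𝓝 0)) :
    Tendsto (fun k => eLpNorm (fun x => |F k x| - |f x|) 2 μ) atTop (𝓝 0) :=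
  tendsto_of_tendsto_of_tendsto_of_le_of_le tendsto_const_nhds h (fun _ => zero_le) fun k =>
    eLpNorm_mono fun x => by
      rw [Real.norm_eq_abs, Real.norm_eq_abs]
      exact abs_abs_sub_abs_le _ _

end L2

/-! ### Weak derivatives and test functions -/

section Sobolev

variable {E : Type*} [NormedAddCommGroup E] [NormedSpace ℝ E] [FiniteDimensional ℝ E]
  [MeasurableSpace E] [BorelSpace E] {μ : Measure E} [μ.IsAddHaarMeasure]

/-- The real function `g` is the weak derivative of `f` in the direction `u`. -/
def HasWeakDeriv (μ : Measure E) (f g : E → ℝ) (u : E) : Prop :=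
  ∀ η : E → ℝ, ContDiff ℝ ∞ η → HasCompactSupport η →
    ∫ x, η x * g x ∂μ = -∫ x, lineDeriv ℝ η x u * f x ∂μ

/-- Translations act continuously on `L²`. -/
theorem tendsto_eLpNorm_translate_sub {f : E → ℝ} (hf : MemLp f 2 μ) :
    Tendsto (fun y => eLpNorm (fun x => f (x - y) - f x) 2 μ) (𝓝 0) (𝓝 0) := by
  let G : C(E, C(E, E)) := (ContinuousMap.mk (fun p : E × E => p.2 - p.1) (by fun_prop)).curry
  have hmp : ∀ y, MeasurePreserving (G y) μ μ := fun y => measurePreserving_sub_right μ y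
  have key := (Continuous.compMeasurePreservingLp (p := 2) (f := fun _ : E => hf.toLp f) (g := G)
    continuous_const G.continuous hmp (by norm_num)).tendsto 0
  rw [tendsto_iff_edist_tendsto_0] at key
  refine key.congr fun y => ?_
  rw [Lp.edist_def]
  refine eLpNorm_congr_ae ?_
  have h1 := hf.coeFn_toLp
  have h2 := (hmp y).quasiMeasurePreserving.ae_eq_comp h1
  have h3 := (hmp 0).quasiMeasurePreserving.ae_eq_comp h1
  filter_upwards [Lp.coeFn_compMeasurePreserving (hf.toLp f) (hmp y),
    Lp.coeFn_compMeasurePreserving (hf.toLp f) (hmp 0), h2, h3] with x a b c d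
  simp only [Pi.sub_apply]
  rw [a, b, c, d]
  simp [G]

/-- Jensen's inequality: averaging `f` over translations by vectors in the support of a
probability density `ρ` moves `f` in `L²` no further than these translations do. -/
theorem eLpNorm_convolution_sub_le {ρ f : E → ℝ} (hρ : Continuous ρ) (hc : HasCompactSupport ρ)
    (h0 : ∀ y, 0 ≤ ρ y) (h1 : ∫ y, ρ y ∂μ = 1) (hf : MemLp f 2 μ) {δ : ℝ≥0∞}
    (hδ : ∀ y, ρ y ≠ 0 → eLpNorm (fun x => f (x - y) - f x) 2 μ ≤ δ) :
    eLpNorm (fun x => (ρ ⋆[ContinuousLinearMap.mul ℝ ℝ, μ] f) x - f x) 2 μ ≤ δ := by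
  wlog hm : StronglyMeasurable f generalizing f
  · obtain ⟨f', hf', hff'⟩ := hf.1
    have hconv : (ρ ⋆[ContinuousLinearMap.mul ℝ ℝ, μ] f) =
        (ρ ⋆[ContinuousLinearMap.mul ℝ ℝ, μ] f') := convolution_congr _ .rfl hff'
    have := this (f := f') (hf.ae_eq hff') (fun y hy => ?_) hf'
    · refine (eLpNorm_congr_ae ?_).trans_le this
      filter_upwards [hff'] with x hx
      rw [hconv, hx]
    · refine (eLpNorm_congr_ae ?_).trans_le (hδ y hy)
      filter_upwards [hff', (measurePreserving_sub_right μ y).quasiMeasurePreserving.ae_eq_comp hff']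
        with x hx hx'
      simp only [Function.comp_apply] at hx'
      rw [hx, hx']
  set ν : Measure E := μ.withDensity fun y => ENNReal.ofReal (ρ y) with hν
  have hρi : Integrable ρ μ := hρ.integrable_of_hasCompactSupport hc
  have hmeas : Measurable fun y => ENNReal.ofReal (ρ y) := hρ.measurable.ennreal_ofReal
  have hprob : IsProbabilityMeasure ν := ⟨by
    rw [hν, withDensity_apply _ MeasurableSet.univ, setLIntegral_univ,
      ← ofReal_integral_eq_lintegral_ofReal hρi (ae_of_all _ h0), h1, ENNReal.ofReal_one]⟩
  have hloc : LocallyIntegrable f μ := hf.locallyIntegrable (by norm_num)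
  have hpt : ∀ x, ‖(ρ ⋆[ContinuousLinearMap.mul ℝ ℝ, μ] f) x - f x‖ₑ ≤
      ∫⁻ y, ‖f (x - y) - f x‖ₑ ∂ν := by
    intro x
    have hex : Integrable (fun y => ρ y * f (x - y)) μ :=
      hc.convolutionExists_left (ContinuousLinearMap.mul ℝ ℝ) hρ hloc x
    have e1 : (ρ ⋆[ContinuousLinearMap.mul ℝ ℝ, μ] f) x - f x =
        ∫ y, ρ y * (f (x - y) - f x) ∂μ := by
      simp only [mul_sub]
      rw [integral_sub hex (hρi.mul_const _), integral_mul_const, h1, one_mul]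
      rfl
    rw [e1, hν, lintegral_withDensity_eq_lintegral_mul _ hmeas
      (g := fun y => ‖f (x - y) - f x‖ₑ)
      (((hm.measurable.comp (measurable_const.sub measurable_id)).sub measurable_const).enorm)]
    refine (enorm_integral_le_lintegral_enorm _).trans (lintegral_mono fun y => ?_)
    simp only [Pi.mul_apply, enorm_mul]
    gcongr
    rw [Real.enorm_eq_ofReal (h0 y)]
  have hmeas2 : Measurable fun p : E × E => ‖f (p.1 - p.2) - f p.1‖ₑ ^ (2 : ℝ) :=
    ((((hm.measurable.comp (measurable_fst.sub measurable_snd)).sub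
      (hm.measurable.comp measurable_fst))).enorm).pow_const _
  have hsq : ∀ g : E → ℝ, eLpNorm g 2 μ = (∫⁻ x, ‖g x‖ₑ ^ (2 : ℝ) ∂μ) ^ (1 / (2 : ℝ)) := fun g => by
    rw [eLpNorm_eq_lintegral_rpow_enorm_toReal (by norm_num) (by norm_num)]; norm_num
  have hsq' : ∀ x, (∫⁻ y, ‖f (x - y) - f x‖ₑ ∂ν) ^ (2 : ℝ) ≤
      ∫⁻ y, ‖f (x - y) - f x‖ₑ ^ (2 : ℝ) ∂ν := by
    intro x
    have hae : AEStronglyMeasurable (fun y => f (x - y) - f x) ν :=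
      ((hm.comp_measurable (measurable_const.sub measurable_id)).sub
        stronglyMeasurable_const).aestronglyMeasurable
    have := eLpNorm_le_eLpNorm_of_exponent_le (μ := ν) (p := 1) (q := 2) (by norm_num) hae
    rw [eLpNorm_one_eq_lintegral_enorm,
      eLpNorm_eq_lintegral_rpow_enorm_toReal (by norm_num) (by norm_num)] at this
    have h2 := ENNReal.rpow_le_rpow this (z := 2) (by norm_num)
    rw [← ENNReal.rpow_mul] at h2
    norm_num at h2
    exact_mod_cast h2
  have hfin : ∫⁻ x, ‖(ρ ⋆[ContinuousLinearMap.mul ℝ ℝ, μ] f) x - f x‖ₑ ^ (2 : ℝ) ∂μ ≤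
      δ ^ (2 : ℝ) := by
    calc _ ≤ ∫⁻ x, ∫⁻ y, ‖f (x - y) - f x‖ₑ ^ (2 : ℝ) ∂ν ∂μ :=
          lintegral_mono fun x => (ENNReal.rpow_le_rpow (hpt x) (by norm_num)).trans (hsq' x)
      _ = ∫⁻ y, ∫⁻ x, ‖f (x - y) - f x‖ₑ ^ (2 : ℝ) ∂μ ∂ν :=
          lintegral_lintegral_swap hmeas2.aemeasurable
      _ ≤ ∫⁻ y, δ ^ (2 : ℝ) ∂ν := by
          refine lintegral_mono_ae ?_
          rw [hν, ae_withDensity_iff hmeas]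
          refine ae_of_all _ fun y hy => ?_
          have := hδ y (fun h => hy (by rw [h, ENNReal.ofReal_zero]))
          rw [hsq] at this
          have h2 := ENNReal.rpow_le_rpow this (z := 2) (by norm_num)
          rw [← ENNReal.rpow_mul] at h2
          norm_num at h2
          exact_mod_cast h2
      _ = δ ^ (2 : ℝ) := by simp
  rw [hsq]
  calc _ ≤ (δ ^ (2 : ℝ)) ^ (1 / (2 : ℝ)) := ENNReal.rpow_le_rpow hfin (by norm_num)
    _ = δ := by rw [← ENNReal.rpow_mul]; norm_num

/-- Mollifications of a square-integrable function converge to it, by the continuity of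
translations in `L²`. -/
theorem tendsto_eLpNorm_convolution_sub {φ : ℕ → ContDiffBump (0 : E)}
    (hφ : Tendsto (fun k => (φ k).rOut) atTop (𝓝 0)) {f : E → ℝ} (hf : MemLp f 2 μ) :
    Tendsto (fun k => eLpNorm
      (fun x => ((φ k).normed μ ⋆[ContinuousLinearMap.mul ℝ ℝ, μ] f) x - f x) 2 μ)
      atTop (𝓝 0) := by
  rw [ENNReal.tendsto_nhds_zero]
  intro δ hδ
  have h1 := (ENNReal.tendsto_nhds_zero.mp (tendsto_eLpNorm_translate_sub hf)) δ hδ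
  obtain ⟨r, hr, hball⟩ := Metric.eventually_nhds_iff_ball.mp h1
  filter_upwards [hφ.eventually (gt_mem_nhds hr)] with k hk
  refine eLpNorm_convolution_sub_le (φ k).continuous_normed (φ k).hasCompactSupport_normed
    (φ k).nonneg_normed (φ k).integral_normed hf fun y hy => hball y ?_
  have : y ∈ Function.support ((φ k).normed μ) := hy
  rw [(φ k).support_normed_eq] at this
  exact Metric.ball_subset_ball hk.le this

/-- Mollification commutes with weak differentiation. -/
theorem HasWeakDeriv.lineDeriv_convolution {ρ f g : E → ℝ} {u : E} (h : HasWeakDeriv μ f g u)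
    (hf : LocallyIntegrable f μ) (hρ : ContDiff ℝ ∞ ρ) (hc : HasCompactSupport ρ) (x : E) :
    lineDeriv ℝ (ρ ⋆[ContinuousLinearMap.mul ℝ ℝ, μ] f) x u =
      (ρ ⋆[ContinuousLinearMap.mul ℝ ℝ, μ] g) x := by
  have hd := hc.hasFDerivAt_convolution_left (ContinuousLinearMap.mul ℝ ℝ)
    (hρ.of_le (by simp)) hf x
  rw [(hd.hasLineDerivAt u).lineDeriv]
  have hex : ConvolutionExistsAt (fderiv ℝ ρ) f x
      (ContinuousLinearMap.precompL E (ContinuousLinearMap.mul ℝ ℝ)) μ :=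
    (hc.fderiv ℝ).convolutionExists_left _ (hρ.continuous_fderiv (by simp)) hf x
  rw [convolution_def, ContinuousLinearMap.integral_apply hex]
  have hη : ContDiff ℝ ∞ fun y => ρ (x - y) := hρ.comp (contDiff_const.sub contDiff_id)
  have hηc : HasCompactSupport fun y => ρ (x - y) :=
    hc.comp_homeomorph (Homeomorph.subLeft x)
  have hL : ∀ y, lineDeriv ℝ (fun y => ρ (x - y)) y u = -fderiv ℝ ρ (x - y) u := by
    intro y
    have h1 : HasFDerivAt ρ (fderiv ℝ ρ (x - y)) (x - y) :=
      (hρ.differentiable (by simp) _).hasFDerivAt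
    have h2 := h1.comp y ((hasFDerivAt_id y).const_sub x)
    have h3 := (h2.hasLineDerivAt u).lineDeriv
    simpa [Function.comp_def] using h3
  have := h _ hη hηc
  simp only [hL, neg_mul, integral_neg, neg_neg] at this
  rw [convolution_def]
  simp only [ContinuousLinearMap.mul_apply']
  rw [← integral_sub_left_eq_self (fun t => ρ t * g (x - t)) μ x]
  simp only [sub_sub_cancel]
  rw [this]
  rw [← integral_sub_left_eq_self _ μ x]
  simp [ContinuousLinearMap.precompL_apply]

/-- Smooth functions of compact support are dense in `H¹`: a square-integrable function with
square-integrable weak derivatives is approximated, together with these, by cut-off mollifications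
of it. -/
theorem exists_test_approx {ι : Type*} {f : E → ℝ} (hf : MemLp f 2 μ) (u : ι → E)
    {g : ι → E → ℝ} (hg : ∀ i, MemLp (g i) 2 μ) (hfg : ∀ i, HasWeakDeriv μ f (g i) (u i)) :
    ∃ η : ℕ → E → ℝ, (∀ k, ContDiff ℝ ∞ (η k)) ∧ (∀ k, HasCompactSupport (η k)) ∧
      Tendsto (fun k => eLpNorm (fun x => η k x - f x) 2 μ) atTop (𝓝 0) ∧
      ∀ i, Tendsto (fun k => eLpNorm (fun x => lineDeriv ℝ (η k) x (u i) - g i x) 2 μ)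
        atTop (𝓝 0) := by
  let φ : ℕ → ContDiffBump (0 : E) := fun k =>
    ⟨1 / (2 * ((k : ℝ) + 1)), 1 / ((k : ℝ) + 1), by positivity, by
      apply one_div_lt_one_div_of_lt <;> nlinarith [(Nat.cast_nonneg k : (0 : ℝ) ≤ k)]⟩
  have hφ : Tendsto (fun k => (φ k).rOut) atTop (𝓝 0) := tendsto_one_div_add_atTop_nhds_zero_nat
  let χ : ContDiffBump (0 : E) := ⟨1, 2, one_pos, one_lt_two⟩
  let t : ℕ → ℝ := fun k => 1 / ((k : ℝ) + 1)
  have ht : Tendsto t atTop (𝓝 0) := tendsto_one_div_add_atTop_nhds_zero_nat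
  have ht0 : ∀ k, 0 < t k := fun k => by positivity
  let M : ℕ → (E → ℝ) → E → ℝ := fun k h =>
    (φ k).normed μ ⋆[ContinuousLinearMap.mul ℝ ℝ, μ] h
  let X : ℕ → E → ℝ := fun k x => χ (t k • x)
  have hloc : ∀ {h : E → ℝ}, MemLp h 2 μ → LocallyIntegrable h μ := fun h =>
    h.locallyIntegrable (by norm_num)
  have hMs : ∀ k {h : E → ℝ}, MemLp h 2 μ → ContDiff ℝ ∞ (M k h) := fun k h hh =>
    (φ k).hasCompactSupport_normed.contDiff_convolution_left _ (φ k).contDiff_normed (hloc hh)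
  have hXs : ∀ k, ContDiff ℝ ∞ (X k) := fun k => χ.contDiff.comp (contDiff_const_smul (t k))
  have hXc : ∀ k, HasCompactSupport (X k) := fun k =>
    χ.hasCompactSupport.comp_smul (ht0 k).ne'
  have hX1 : ∀ k x, |X k x| ≤ 1 := fun k x => by
    rw [abs_of_nonneg χ.nonneg]; exact χ.le_one
  have hXlim : ∀ x, Tendsto (fun k => X k x) atTop (𝓝 1) := fun x => by
    have h1 : Tendsto (fun k => t k • x) atTop (𝓝 0) := by simpa using ht.smul_const x
    have h2 := (χ.continuous.tendsto 0).comp h1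
    have h3 : χ (0 : E) = 1 := χ.one_of_mem_closedBall (by simp [χ])
    rwa [h3] at h2
  -- Cutting off a convergent sequence does not change its limit.
  have hcut : ∀ {h : E → ℝ}, MemLp h 2 μ →
      Tendsto (fun k => eLpNorm (fun x => X k x * M k h x - h x) 2 μ) atTop (𝓝 0) := by
    intro h hh
    have a1 := tendsto_eLpNorm_convolution_sub hφ hh
    have a2 : Tendsto (fun k => eLpNorm (fun x => X k x * h x - h x) 2 μ) atTop (𝓝 0) := by
      refine tendsto_eLpNorm_sub_of_dominated (G := fun x => 2 * |h x|) (hh.abs.const_mul 2)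
        (fun k => (hXs k).continuous.aestronglyMeasurable.mul hh.1) hh.1 (fun k x => ?_) ?_
      · rw [show X k x * h x - h x = (X k x - 1) * h x by ring, abs_mul]
        gcongr
        calc |X k x - 1| ≤ |X k x| + |(1 : ℝ)| := abs_sub _ _
          _ ≤ 2 := by rw [abs_one]; linarith [hX1 k x]
      · exact ae_of_all _ fun x => by simpa using (hXlim x).mul_const (h x)
    have a3 := a1.add a2
    rw [add_zero] at a3
    refine tendsto_of_tendsto_of_tendsto_of_le_of_le tendsto_const_nhds a3 (fun _ => zero_le)
      fun k => ?_
    have hMm : AEStronglyMeasurable (M k h) μ := (hMs k hh).continuous.aestronglyMeasurable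
    have hXm : AEStronglyMeasurable (X k) μ := (hXs k).continuous.aestronglyMeasurable
    calc eLpNorm (fun x => X k x * M k h x - h x) 2 μ
        = eLpNorm ((fun x => X k x * (M k h x - h x)) + fun x => X k x * h x - h x) 2 μ := by
          congr 1; ext x; simp only [Pi.add_apply]; ring
      _ ≤ eLpNorm (fun x => X k x * (M k h x - h x)) 2 μ +
          eLpNorm (fun x => X k x * h x - h x) 2 μ :=
        eLpNorm_add_le (hXm.mul (hMm.sub hh.1)) ((hXm.mul hh.1).sub hh.1) (by norm_num)
      _ ≤ _ := by
        refine add_le_add ?_ le_rfl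
        refine eLpNorm_mono fun x => ?_
        rw [norm_mul]
        exact mul_le_of_le_one_left (norm_nonneg _) (hX1 k x)
  refine ⟨fun k x => X k x * M k f x, fun k => (hXs k).mul (hMs k hf),
    fun k => (hXc k).mul_right, hcut hf, fun i => ?_⟩
  -- The derivative of the cutoff has size `O(t k)` and tends to zero.
  obtain ⟨C, hC⟩ : ∃ C : ℝ, ∀ y, |fderiv ℝ χ y (u i)| ≤ C := by
    have hcont : Continuous fun y => fderiv ℝ χ y (u i) :=
      (χ.contDiff (n := 1).continuous_fderiv (by simp)).clm_apply continuous_const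
    obtain ⟨C, hC⟩ := hcont.bounded_above_of_compact_support
      (χ.hasCompactSupport.fderiv_apply (𝕜 := ℝ) (u i))
    exact ⟨C, hC⟩
  have hder : ∀ k x, lineDeriv ℝ (fun x => X k x * M k f x) x (u i) =
      (t k * fderiv ℝ χ (t k • x) (u i)) * M k f x + X k x * M k (g i) x := by
    intro k x
    have d1 : HasFDerivAt (M k f) (fderiv ℝ (M k f) x) x :=
      ((hMs k hf).differentiable (by simp) x).hasFDerivAt
    have d2 : HasFDerivAt χ (fderiv ℝ χ (t k • x)) (t k • x) :=
      (χ.contDiff.differentiable (n := 1) (by simp) _).hasFDerivAt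
    have d3 : HasFDerivAt (X k) _ x := d2.comp x ((hasFDerivAt_id x).const_smul (t k))
    refine ((d3.mul d1).hasLineDerivAt (u i)).lineDeriv.trans ?_
    have d4 : fderiv ℝ (M k f) x (u i) = M k (g i) x := by
      rw [← (d1.hasLineDerivAt (u i)).lineDeriv]
      exact (hfg i).lineDeriv_convolution (hloc hf) (φ k).contDiff_normed
        (φ k).hasCompactSupport_normed x
    simp only [add_apply, smul_apply, d4,
      ContinuousLinearMap.comp_apply, ContinuousLinearMap.id_apply, map_smul, smul_eq_mul]
    ring
  have b1 := hcut (hg i)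
  have b2 : Tendsto (fun k => eLpNorm
      (fun x => (t k * fderiv ℝ χ (t k • x) (u i)) * M k f x) 2 μ) atTop (𝓝 0) := by
    have c1 : Tendsto (fun k => eLpNorm (fun x => M k f x - f x) 2 μ + eLpNorm f 2 μ) atTop
        (𝓝 (0 + eLpNorm f 2 μ)) := (tendsto_eLpNorm_convolution_sub hφ hf).add_const _
    have c2 : Tendsto (fun k => ENNReal.ofReal (t k * C)) atTop (𝓝 0) := by
      have := ENNReal.tendsto_ofReal (ht.mul_const C)
      simpa using this
    have c3 := ENNReal.Tendsto.mul c2 (Or.inr (by simpa using hf.eLpNorm_ne_top)) c1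
      (Or.inr ENNReal.zero_ne_top)
    rw [zero_mul] at c3
    refine tendsto_of_tendsto_of_tendsto_of_le_of_le tendsto_const_nhds c3 (fun _ => zero_le)
      fun k => ?_
    have hMm : AEStronglyMeasurable (M k f) μ := (hMs k hf).continuous.aestronglyMeasurable
    calc _ ≤ ENNReal.ofReal (t k * C) * eLpNorm (M k f) 2 μ := by
          refine eLpNorm_le_mul_eLpNorm_of_ae_le_mul (ae_of_all _ fun x => ?_) 2
          rw [norm_mul, norm_mul, Real.norm_of_nonneg (ht0 k).le]
          gcongr
          exact hC _
      _ ≤ _ := by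
          gcongr
          calc eLpNorm (M k f) 2 μ = eLpNorm ((fun x => M k f x - f x) + f) 2 μ := by
                congr 1; ext x; simp
            _ ≤ _ := eLpNorm_add_le (hMm.sub hf.1) hf.1 (by norm_num)
  have b3 := b2.add b1
  rw [add_zero] at b3
  refine tendsto_of_tendsto_of_tendsto_of_le_of_le tendsto_const_nhds b3 (fun _ => zero_le)
    fun k => ?_
  have m1 : AEStronglyMeasurable (fun x => (t k * fderiv ℝ χ (t k • x) (u i)) * M k f x) μ := by
    refine Continuous.aestronglyMeasurable (Continuous.mul (continuous_const.mul ?_)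
      (hMs k hf).continuous)
    exact ((χ.contDiff (n := 1).continuous_fderiv (by simp)).comp
      (continuous_const_smul (t k))).clm_apply continuous_const
  have m2 : AEStronglyMeasurable (fun x => X k x * M k (g i) x - g i x) μ :=
    ((hXs k).continuous.aestronglyMeasurable.mul
      (hMs k (hg i)).continuous.aestronglyMeasurable).sub (hg i).1
  refine (eLpNorm_congr_ae (ae_of_all _ fun x => ?_)).trans_le (eLpNorm_add_le m1 m2 (by norm_num))
  simp only [Pi.add_apply, hder]
  ring

end Sobolev

/-! ### Relative positions and smoothed distances -/

section Configurations

variable {d n : ℕ}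

/-- The position of a particle, as a linear function of the relative coordinates. -/
noncomputable def posCLM (i : Fin (n + 1)) : Config d n →L[ℝ] EuclideanSpace ℝ (Fin d) :=
  Fin.cases 0 (fun i => PiLp.proj 2 (fun _ : Fin n => EuclideanSpace ℝ (Fin d)) i) i

theorem posCLM_apply (i : Fin (n + 1)) (x : Config d n) : posCLM i x = pos x i := by
  refine Fin.cases ?_ (fun i => ?_) i <;> simp [pos, posCLM]

/-- The vector `r_j - r_i` from particle `i` to particle `j`, as a linear function of the relative
coordinates. -/
noncomputable def sep (i j : Fin (n + 1)) : Config d n →L[ℝ] EuclideanSpace ℝ (Fin d) :=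
  posCLM j - posCLM i

theorem sep_apply (i j : Fin (n + 1)) (x : Config d n) : sep i j x = pos x j - pos x i := by
  rw [← posCLM_apply, ← posCLM_apply]; rfl

theorem sep_self (i : Fin (n + 1)) (x : Config d n) : sep i i x = 0 := by rw [sep_apply, sub_self]

theorem sep_swap (i j : Fin (n + 1)) (x : Config d n) : sep j i x = -sep i j x := by
  rw [sep_apply, sep_apply, neg_sub]

theorem sep_rel (i j : Fin (n + 1)) (r : Fin (n + 1) → EuclideanSpace ℝ (Fin d)) :
    sep i j (rel r) = r j - r i := by
  have h : ∀ l, pos (rel r) l = r l - r 0 := fun l => by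
    refine Fin.cases ?_ (fun l => ?_) l <;> simp [pos, rel]
  rw [sep_apply, h j, h i, sub_sub_sub_cancel_right]

theorem sep_dir (i j l : Fin (n + 1)) (k : Fin d) :
    sep i j (dir l k : Config d n) =
      ((if j = l then 1 else 0) - (if i = l then 1 else 0) : ℝ) • EuclideanSpace.single k (1 : ℝ) := by
  rw [dir, sep_rel, sub_smul]
  congr 1 <;> · rw [Pi.single_apply]; split_ifs <;> simp

theorem ae_sep_ne_zero (hd : 0 < d) {i j : Fin (n + 1)} (hij : i ≠ j) :
    ∀ᵐ x : Config d n, sep i j x ≠ 0 := by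
  have h := Measure.addHaar_submodule (volume : Measure (Config d n))
    (LinearMap.ker (sep i j : Config d n →L[ℝ] EuclideanSpace ℝ (Fin d)).toLinearMap) (by
      intro h
      rw [LinearMap.ker_eq_top] at h
      have h1 := sep_dir (d := d) i j j ⟨0, hd⟩
      rw [if_pos rfl, if_neg hij] at h1
      have h2 : sep i j (dir j ⟨0, hd⟩ : Config d n) = 0 := congrArg (· (dir j ⟨0, hd⟩)) h
      rw [h2] at h1
      simpa using congrArg (· ⟨0, hd⟩) h1)
  filter_upwards [compl_mem_ae_iff.mpr h] with x hx h0
  exact hx h0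

theorem ae_forall_sep_ne_zero (hd : 0 < d) :
    ∀ᵐ x : Config d n, ∀ i j : Fin (n + 1), i ≠ j → sep i j x ≠ 0 := by
  refine ae_all_iff.mpr fun i => ae_all_iff.mpr fun j => ?_
  by_cases hij : i = j
  · exact ae_of_all _ fun x h => absurd hij h
  · filter_upwards [ae_sep_ne_zero (d := d) hd hij] with x hx _
    exact hx

theorem potential_eq (x : Config d n) :
    potential x = -(1 / 2 : ℝ) * ∑ i, ∑ j, ‖sep i j x‖⁻¹ := by
  have h1 : ∀ i j : Fin (n + 1), ‖sep i j x‖⁻¹ =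
      (if i < j then ‖sep i j x‖⁻¹ else 0) + (if j < i then ‖sep i j x‖⁻¹ else 0) := by
    intro i j
    rcases lt_trichotomy i j with h | h | h
    · simp [h, h.not_gt]
    · subst h; simp [sep_self]
    · simp [h, h.not_gt]
  have h2 : ∑ i : Fin (n + 1), ∑ j, (if j < i then ‖sep i j x‖⁻¹ else 0) =
      ∑ i, ∑ j, (if i < j then ‖sep i j x‖⁻¹ else 0) := by
    rw [Finset.sum_comm]
    refine Finset.sum_congr rfl fun i _ => Finset.sum_congr rfl fun j _ => ?_
    rw [sep_swap i j, norm_neg]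
  have h3 : ∑ i, ∑ j, ‖sep i j x‖⁻¹ = 2 * ∑ i, ∑ j ∈ Finset.Ioi i, ‖sep i j x‖⁻¹ := by
    have h4 : ∀ i : Fin (n + 1), ∑ j ∈ Finset.Ioi i, ‖sep i j x‖⁻¹ =
        ∑ j, (if i < j then ‖sep i j x‖⁻¹ else 0) := fun i => by
      rw [← Finset.sum_filter]; congr 1; ext j; simp
    simp only [h4]
    rw [Finset.sum_congr rfl fun i _ => Finset.sum_congr rfl fun j _ => h1 i j]
    simp only [Finset.sum_add_distrib]
    rw [h2]; ring
  rw [h3, potential]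
  simp only [← sep_apply, one_div, Finset.sum_neg_distrib]
  ring

/-- The distance `r_ij`, smoothed at scale `ε` to `(r_ij² + ε²)^{1/2}`. -/
noncomputable def regDist (ε : ℝ) (i j : Fin (n + 1)) (x : Config d n) : ℝ :=
  √(‖sep i j x‖ ^ 2 + ε ^ 2)

theorem regDist_pos {ε : ℝ} (hε : ε ≠ 0) (i j : Fin (n + 1)) (x : Config d n) :
    0 < regDist ε i j x := Real.sqrt_pos.mpr (by positivity)

theorem norm_sep_le_regDist (ε : ℝ) (i j : Fin (n + 1)) (x : Config d n) :
    ‖sep i j x‖ ≤ regDist ε i j x :=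
  Real.le_sqrt_of_sq_le (by linarith [sq_nonneg ε])

theorem regDist_zero (i j : Fin (n + 1)) (x : Config d n) : regDist 0 i j x = ‖sep i j x‖ := by
  simp [regDist]

theorem continuous_regDist (ε : ℝ) (i j : Fin (n + 1)) :
    Continuous (regDist ε i j : Config d n → ℝ) := by
  unfold regDist
  fun_prop

theorem continuous_regDist_left (i j : Fin (n + 1)) (x : Config d n) :
    Continuous fun ε => regDist ε i j x := by
  unfold regDist
  fun_prop

theorem hasDerivAt_sep_line (i j : Fin (n + 1)) (x u : Config d n) :
    HasDerivAt (fun t : ℝ => sep i j (x + t • u)) (sep i j u) 0 := by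
  simp only [map_add, map_smul]
  simpa using ((hasDerivAt_id (0 : ℝ)).smul_const (sep i j u)).const_add (sep i j x)

theorem hasLineDerivAt_regDist {ε : ℝ} (hε : ε ≠ 0) (i j : Fin (n + 1)) (x u : Config d n) :
    HasLineDerivAt ℝ (regDist ε i j)
      (inner ℝ (sep i j x) (sep i j u) / regDist ε i j x) x u := by
  have h1 := ((hasDerivAt_sep_line i j x u).norm_sq.add_const (ε ^ 2)).sqrt (by
    simp only [zero_smul, add_zero]; positivity)
  simp only [zero_smul, add_zero] at h1
  refine HasDerivAt.congr_deriv h1 ?_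
  rw [regDist]
  field_simp

theorem hasLineDerivAt_sep_coord_div {ε : ℝ} (hε : ε ≠ 0) (i j : Fin (n + 1)) (k : Fin d)
    (x u : Config d n) :
    HasLineDerivAt ℝ (fun y => sep i j y k / regDist ε i j y)
      (sep i j u k / regDist ε i j x -
        sep i j x k * inner ℝ (sep i j x) (sep i j u) / regDist ε i j x ^ 3) x u := by
  have h1 : HasDerivAt (fun t : ℝ => sep i j (x + t • u) k) (sep i j u k) 0 :=
    ((EuclideanSpace.proj k : EuclideanSpace ℝ (Fin d) →L[ℝ] ℝ).hasFDerivAt).comp_hasDerivAt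
      (0 : ℝ) (hasDerivAt_sep_line i j x u)
  have hp := regDist_pos hε i j x
  have h2 := h1.div (hasLineDerivAt_regDist hε i j x u) (by
    simp only [zero_smul, add_zero]; exact hp.ne')
  simp only [zero_smul, add_zero] at h2
  refine HasDerivAt.congr_deriv h2 ?_
  field_simp

end Configurations

section IntegrationByParts

variable {E : Type*} [NormedAddCommGroup E] [NormedSpace ℝ E] [FiniteDimensional ℝ E]
  [MeasurableSpace E] [BorelSpace E] {μ : Measure E} [μ.IsAddHaarMeasure]

theorem integral_mul_hasLineDerivAt_eq_neg {η F F' : E → ℝ} {u : E} (hη : ContDiff ℝ 1 η)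
    (hc : HasCompactSupport η) (hF : Continuous F) (hF' : Continuous F')
    (h : ∀ x, HasLineDerivAt ℝ F (F' x) x u) :
    ∫ x, η x * F' x ∂μ = -∫ x, lineDeriv ℝ η x u * F x ∂μ := by
  have hd : ∀ x, HasFDerivAt η (fderiv ℝ η x) x := fun x =>
    (hη.differentiable (by simp) x).hasFDerivAt
  have hl : (fun x => lineDeriv ℝ η x u) = fun x => fderiv ℝ η x u := by
    ext x; exact ((hd x).hasLineDerivAt u).lineDeriv
  have hlc : Continuous fun x => lineDeriv ℝ η x u := by
    rw [hl]; exact (hη.continuous_fderiv (by simp)).clm_apply continuous_const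
  have hls : HasCompactSupport fun x => lineDeriv ℝ η x u := by
    rw [hl]; exact hc.fderiv_apply (𝕜 := ℝ) u
  exact integral_bilinear_hasLineDerivAt_right_eq_neg_left_of_integrable
    (B := ContinuousLinearMap.mul ℝ ℝ)
    ((hlc.mul hF).integrable_of_hasCompactSupport hls.mul_right)
    ((hη.continuous.mul hF').integrable_of_hasCompactSupport hc.mul_right)
    ((hη.continuous.mul hF).integrable_of_hasCompactSupport hc.mul_right)
    (fun x _ => by rw [congrFun hl x]; exact (hd x).hasLineDerivAt u) (fun x _ => h x)

end IntegrationByParts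

/-! ### The weak Hardy inequality -/

section Hardy

variable {d n : ℕ}

theorem lineDeriv_sq {η : Config d n → ℝ} (hη : ContDiff ℝ ∞ η) (x u : Config d n) :
    lineDeriv ℝ (fun x => η x ^ 2) x u = 2 * (η x * lineDeriv ℝ η x u) := by
  have h1 : HasFDerivAt η (fderiv ℝ η x) x := (hη.differentiable (by simp) x).hasFDerivAt
  rw [((h1.pow 2).hasLineDerivAt u).lineDeriv, (h1.hasLineDerivAt u).lineDeriv]
  simp [mul_assoc]

theorem continuous_sep_coord_div {ε : ℝ} (hε : ε ≠ 0) (i j : Fin (n + 1)) (k : Fin d) :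
    Continuous fun x : Config d n => sep i j x k / regDist ε i j x :=
  Continuous.div (by fun_prop) (continuous_regDist ε i j) fun x => (regDist_pos hε i j x).ne'

theorem abs_sep_coord_div_le (ε : ℝ) (i j : Fin (n + 1)) (k : Fin d) (x : Config d n) :
    |sep i j x k / regDist ε i j x| ≤ 1 := by
  rw [abs_div, abs_of_nonneg (show 0 ≤ regDist ε i j x from Real.sqrt_nonneg _)]
  exact div_le_one_of_le₀ ((PiLp.norm_apply_le (sep i j x) k).trans (norm_sep_le_regDist ε i j x))
    (Real.sqrt_nonneg _)

theorem inner_sep_dir {i j : Fin (n + 1)} (hij : i ≠ j) (k : Fin d)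
    (z : EuclideanSpace ℝ (Fin d)) : inner ℝ z (sep i j (dir j k : Config d n)) = z k := by
  rw [sep_dir, if_pos rfl, if_neg hij, sub_zero, one_smul, EuclideanSpace.inner_single_right]
  simp

/-- The weak Hardy inequality `∫ η²/r ≤ 2 ∑ₖ ∫ |η| |∂ₖη|` for test functions, obtained by
integrating `η²` against the divergence of `z/ρ`, where `z = r_j - r_i` and `ρ` is the smoothed
distance: this divergence is at least `(d - 1)/ρ`. -/
theorem integral_sq_div_regDist_le_of_test (hd : 2 ≤ d) {i j : Fin (n + 1)} (hij : i ≠ j) {ε : ℝ}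
    (hε : ε ≠ 0) {η : Config d n → ℝ} (hη : ContDiff ℝ ∞ η) (hc : HasCompactSupport η) :
    ∫ x, η x * (η x / regDist ε i j x) ≤
      2 * ∑ k, ∫ x, |η x| * |lineDeriv ℝ η x (dir j k)| := by
  set ρ : Config d n → ℝ := regDist ε i j with hρ
  have hρc : Continuous ρ := continuous_regDist ε i j
  have hρ0 : ∀ x, 0 < ρ x := regDist_pos hε i j
  have hη2 : ContDiff ℝ ∞ fun x => η x ^ 2 := hη.pow 2
  have hc2 : HasCompactSupport fun x => η x ^ 2 := by
    simp only [pow_two]; exact hc.mul_right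
  have hFc : ∀ k, Continuous fun x : Config d n => 1 / ρ x - sep i j x k ^ 2 / ρ x ^ 3 := fun k =>
    ((continuous_const.div hρc fun x => (hρ0 x).ne').sub
      (Continuous.div (by fun_prop) (hρc.pow 3) fun x => (pow_pos (hρ0 x) 3).ne'))
  have hibp : ∀ k, ∫ x, η x ^ 2 * (1 / ρ x - sep i j x k ^ 2 / ρ x ^ 3) ≤
      2 * ∫ x, |η x| * |lineDeriv ℝ η x (dir j k)| := by
    intro k
    have hL := contDiff_lineDeriv hη (dir j k)
    rw [integral_mul_hasLineDerivAt_eq_neg (hη2.of_le (by simp)) hc2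
      (continuous_sep_coord_div hε i j k) (hFc k) (u := dir j k) fun x => ?_]
    · rw [← integral_neg, ← integral_const_mul]
      refine integral_mono ?_ ?_ fun x => ?_
      · refine Continuous.integrable_of_hasCompactSupport
          (((contDiff_lineDeriv hη2 _).continuous.mul (continuous_sep_coord_div hε i j k)).neg) ?_
        exact ((hasCompactSupport_lineDeriv hη2 hc2 _).mul_right).neg
      · exact (continuous_const.mul (hη.continuous.abs.mul hL.continuous.abs)
          ).integrable_of_hasCompactSupport ((HasCompactSupport.mul_right
            (hc.comp_left abs_zero)).mul_left)
      · simp only [lineDeriv_sq hη]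
        refine (neg_le_abs _).trans ?_
        rw [abs_mul, abs_mul, abs_mul, abs_two]
        exact mul_le_of_le_one_right (by positivity) (abs_sep_coord_div_le ε i j k x)
    · refine (hasLineDerivAt_sep_coord_div hε i j k x (dir j k)).congr_deriv ?_
      have h1 : sep i j (dir j k : Config d n) k = 1 := by
        rw [sep_dir, if_pos rfl, if_neg hij]; simp
      rw [inner_sep_dir hij, h1, pow_two]
  have hint : ∀ k, Integrable fun x : Config d n =>
      η x ^ 2 * (1 / ρ x - sep i j x k ^ 2 / ρ x ^ 3) := fun k =>
    (hη2.continuous.mul (hFc k)).integrable_of_hasCompactSupport hc2.mul_right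
  rw [Finset.mul_sum]
  refine le_trans ?_ (Finset.sum_le_sum fun k _ => hibp k)
  rw [← integral_finsetSum _ fun k _ => hint k]
  refine integral_mono ?_ (integrable_finsetSum _ fun k _ => hint k) fun x => ?_
  · exact (hη.continuous.mul (hη.continuous.div hρc fun x => (hρ0 x).ne')
      ).integrable_of_hasCompactSupport hc.mul_right
  · have hz : ∑ k, sep i j x k ^ 2 = ‖sep i j x‖ ^ 2 := by
      rw [EuclideanSpace.norm_sq_eq]; simp
    have e1 : ∑ k : Fin d, η x ^ 2 * (1 / ρ x - sep i j x k ^ 2 / ρ x ^ 3) =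
        η x ^ 2 * (d / ρ x - ‖sep i j x‖ ^ 2 / ρ x ^ 3) := by
      rw [← Finset.mul_sum, Finset.sum_sub_distrib, ← hz, Finset.sum_div]
      simp [div_eq_mul_inv]
    have e2 : 1 / ρ x ≤ d / ρ x - ‖sep i j x‖ ^ 2 / ρ x ^ 3 := by
      have h2 : ‖sep i j x‖ ^ 2 ≤ ρ x ^ 2 := by
        have := norm_sep_le_regDist ε i j x
        gcongr
      have h3 : ‖sep i j x‖ ^ 2 / ρ x ^ 3 ≤ 1 / ρ x := by
        rw [div_le_div_iff₀ (pow_pos (hρ0 x) 3) (hρ0 x)]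
        nlinarith [hρ0 x]
      have h4 : (2 : ℝ) / ρ x ≤ d / ρ x := by
        have : (2 : ℝ) ≤ d := by exact_mod_cast hd
        have := hρ0 x
        gcongr
      have h5 : (2 : ℝ) / ρ x = 1 / ρ x + 1 / ρ x := by ring
      linarith
    simp only [e1]
    calc η x * (η x / ρ x) = η x ^ 2 * (1 / ρ x) := by ring
      _ ≤ _ := by gcongr

theorem memLp_lineDeriv_of_test {η : Config d n → ℝ} (hη : ContDiff ℝ ∞ η)
    (hc : HasCompactSupport η) (u : Config d n) :
    MemLp (fun x => lineDeriv ℝ η x u) 2 :=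
  (contDiff_lineDeriv hη u).continuous.memLp_of_hasCompactSupport
    (hasCompactSupport_lineDeriv hη hc u)

theorem memLp_div_regDist {ε : ℝ} (hε : 0 < ε) (i j : Fin (n + 1)) {f : Config d n → ℝ}
    (hf : MemLp f 2) : MemLp (fun x => f x / regDist ε i j x) 2 := by
  refine MemLp.of_le_mul (c := ε⁻¹) hf (hf.1.aemeasurable.div
    (continuous_regDist ε i j).measurable.aemeasurable).aestronglyMeasurable
    (ae_of_all _ fun x => ?_)
  rw [norm_div, div_eq_inv_mul, Real.norm_of_nonneg (regDist_pos hε.ne' i j x).le]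
  have : ε ≤ regDist ε i j x := Real.le_sqrt_of_sq_le (by nlinarith [sq_nonneg ‖sep i j x‖])
  exact mul_le_mul_of_nonneg_right (inv_anti₀ hε this) (norm_nonneg _)

/-- The weak Hardy inequality on `H¹`. -/
theorem lintegral_sq_div_norm_sep_le (hd : 2 ≤ d) {i j : Fin (n + 1)} (hij : i ≠ j)
    {f : Config d n → ℝ} (hf : MemLp f 2) {g : Fin d → Config d n → ℝ} (hg : ∀ k, MemLp (g k) 2)
    (hfg : ∀ k, HasWeakDeriv volume f (g k) (dir j k)) :
    ∫⁻ x, ENNReal.ofReal (f x ^ 2 * ‖sep i j x‖⁻¹) ≤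
      ENNReal.ofReal (2 * ∑ k, ∫ x, |f x| * |g k x|) := by
  obtain ⟨η, hη, hc, hlim, hlim'⟩ := exists_test_approx hf (fun k => dir j k) hg hfg
  have hηL : ∀ m, MemLp (η m) 2 := fun m =>
    (hη m).continuous.memLp_of_hasCompactSupport (hc m)
  have hreg : ∀ ε : ℝ, 0 < ε → ∫ x, f x * (f x / regDist ε i j x) ≤
      2 * ∑ k, ∫ x, |f x| * |g k x| := by
    intro ε hε
    have t1 : Tendsto (fun m => ∫ x, η m x * (η m x / regDist ε i j x)) atTop
        (𝓝 (∫ x, f x * (f x / regDist ε i j x))) := by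
      refine tendsto_integral_mul_of_tendsto_eLpNorm hηL hf
        (fun m => memLp_div_regDist hε i j (hηL m)) (memLp_div_regDist hε i j hf) hlim ?_
      have := ENNReal.Tendsto.const_mul (a := ENNReal.ofReal ε⁻¹) hlim
        (Or.inr ENNReal.ofReal_ne_top)
      rw [mul_zero] at this
      refine tendsto_of_tendsto_of_tendsto_of_le_of_le tendsto_const_nhds this (fun _ => zero_le)
        fun m => ?_
      refine eLpNorm_le_mul_eLpNorm_of_ae_le_mul (ae_of_all _ fun x => ?_) 2
      rw [← sub_div, norm_div, div_eq_inv_mul, Real.norm_of_nonneg (regDist_pos hε.ne' i j x).le]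
      have : ε ≤ regDist ε i j x := Real.le_sqrt_of_sq_le (by nlinarith [sq_nonneg ‖sep i j x‖])
      exact mul_le_mul_of_nonneg_right (inv_anti₀ hε this) (norm_nonneg _)
    have t2 : Tendsto (fun m => 2 * ∑ k, ∫ x, |η m x| * |lineDeriv ℝ (η m) x (dir j k)|) atTop
        (𝓝 (2 * ∑ k, ∫ x, |f x| * |g k x|)) := by
      refine (tendsto_finsetSum _ fun k _ => ?_).const_mul 2
      exact tendsto_integral_mul_of_tendsto_eLpNorm (fun m => (hηL m).abs) hf.abs
        (fun m => (memLp_lineDeriv_of_test (hη m) (hc m) _).abs) (hg k).abs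
        (tendsto_eLpNorm_abs_sub hlim) (tendsto_eLpNorm_abs_sub (hlim' k))
    exact le_of_tendsto_of_tendsto' t1 t2 fun m =>
      integral_sq_div_regDist_le_of_test hd hij hε.ne' (hη m) (hc m)
  let t : ℕ → ℝ := fun m => 1 / ((m : ℝ) + 1)
  have ht : Tendsto t atTop (𝓝 0) := tendsto_one_div_add_atTop_nhds_zero_nat
  have ht0 : ∀ m, 0 < t m := fun m => by positivity
  calc ∫⁻ x, ENNReal.ofReal (f x ^ 2 * ‖sep i j x‖⁻¹)
      = ∫⁻ x, liminf (fun m => ENNReal.ofReal (f x * (f x / regDist (t m) i j x))) atTop := by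
        refine lintegral_congr_ae ?_
        filter_upwards [ae_sep_ne_zero (n := n) (by omega) hij] with x hx
        refine (Tendsto.liminf_eq ?_).symm
        refine ENNReal.tendsto_ofReal ?_
        have h1 : Tendsto (fun m => regDist (t m) i j x) atTop (𝓝 ‖sep i j x‖) := by
          have := ((continuous_regDist_left i j x).tendsto 0).comp ht
          rwa [regDist_zero] at this
        have h2 := (h1.inv₀ (norm_ne_zero_iff.mpr hx)).const_mul (f x ^ 2)
        exact h2.congr fun m => by ring
    _ ≤ liminf (fun m => ∫⁻ x, ENNReal.ofReal (f x * (f x / regDist (t m) i j x))) atTop := by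
        refine lintegral_liminf_le' fun m => ?_
        exact (hf.1.aemeasurable.mul
          (memLp_div_regDist (ht0 m) i j hf).1.aemeasurable).ennreal_ofReal
    _ ≤ _ := by
        refine liminf_le_of_frequently_le' (Frequently.of_forall fun m => ?_)
        rw [← ofReal_integral_eq_lintegral_ofReal]
        · exact ENNReal.ofReal_le_ofReal (hreg _ (ht0 m))
        · exact hf.integrable_mul (memLp_div_regDist (ht0 m) i j hf)
        · refine ae_of_all _ fun x => ?_
          change 0 ≤ f x * (f x / regDist (t m) i j x)
          rw [← mul_div_assoc]
          exact div_nonneg (mul_self_nonneg _) (Real.sqrt_nonneg _)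

theorem potential_nonpos (x : Config d n) : potential x ≤ 0 := by
  rw [potential_eq]
  have : 0 ≤ ∑ i, ∑ j, ‖sep i j x‖⁻¹ := by positivity
  linarith

theorem measurable_potential : Measurable (potential : Config d n → ℝ) := by
  have : (potential : Config d n → ℝ) = fun x => -(1 / 2 : ℝ) * ∑ i, ∑ j, ‖sep i j x‖⁻¹ :=
    funext potential_eq
  rw [this]
  refine Measurable.const_mul (Finset.measurable_sum _ fun i _ => Finset.measurable_sum _
    fun j _ => ?_) _
  exact ((sep i j).continuous.norm.measurable).inv

/-- The potential is bounded on `H¹` as a quadratic form. -/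
theorem lintegral_potential_mul_sq_le (hd : 2 ≤ d) {f : Config d n → ℝ} (hf : MemLp f 2)
    {g : Fin (n + 1) × Fin d → Config d n → ℝ} (hg : ∀ p, MemLp (g p) 2)
    (hfg : ∀ p, HasWeakDeriv volume f (g p) (dir p.1 p.2)) :
    ∫⁻ x, ENNReal.ofReal (-potential x * f x ^ 2) ≤
      ENNReal.ofReal (∑ i : Fin (n + 1), ∑ j, 2 * ∑ k, ∫ x, |f x| * |g (j, k) x|) := by
  have h0 : ∀ x, ENNReal.ofReal (-potential x * f x ^ 2) ≤
      ∑ i, ∑ j, ENNReal.ofReal (f x ^ 2 * ‖sep i j x‖⁻¹) := by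
    intro x
    have e1 : ∑ i, ∑ j, ENNReal.ofReal (f x ^ 2 * ‖sep i j x‖⁻¹) =
        ENNReal.ofReal (∑ i, ∑ j, f x ^ 2 * ‖sep i j x‖⁻¹) := by
      rw [ENNReal.ofReal_sum_of_nonneg fun _ _ => by positivity]
      refine Finset.sum_congr rfl fun i _ => ?_
      rw [ENNReal.ofReal_sum_of_nonneg fun _ _ => by positivity]
    have e2 : ∑ i, ∑ j, f x ^ 2 * ‖sep i j x‖⁻¹ = f x ^ 2 * ∑ i, ∑ j, ‖sep i j x‖⁻¹ := by
      rw [Finset.mul_sum]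
      exact Finset.sum_congr rfl fun i _ => (Finset.mul_sum _ _ _).symm
    rw [e1, e2]
    refine ENNReal.ofReal_le_ofReal ?_
    rw [potential_eq]
    have : 0 ≤ f x ^ 2 * ∑ i, ∑ j, ‖sep i j x‖⁻¹ := by positivity
    nlinarith
  have hm : ∀ i j : Fin (n + 1), AEMeasurable
      (fun x => ENNReal.ofReal (f x ^ 2 * ‖sep i j x‖⁻¹)) volume := fun i j =>
    ((hf.1.aemeasurable.pow_const 2).mul
      ((sep i j).continuous.norm.measurable.inv).aemeasurable).ennreal_ofReal
  have hI : ∀ i j : Fin (n + 1), 0 ≤ 2 * ∑ k, ∫ x, |f x| * |g (j, k) x| := fun i j =>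
    mul_nonneg zero_le_two (Finset.sum_nonneg fun k _ => integral_nonneg fun x => by positivity)
  calc _ ≤ ∫⁻ x, ∑ i, ∑ j, ENNReal.ofReal (f x ^ 2 * ‖sep i j x‖⁻¹) := lintegral_mono h0
    _ = ∑ i, ∑ j, ∫⁻ x, ENNReal.ofReal (f x ^ 2 * ‖sep i j x‖⁻¹) := by
      rw [lintegral_finsetSum' _ fun i _ => Finset.aemeasurable_fun_sum _ fun j _ => hm i j]
      exact Finset.sum_congr rfl fun i _ => lintegral_finsetSum' _ fun j _ => hm i j
    _ ≤ ∑ i, ∑ j, ENNReal.ofReal (2 * ∑ k, ∫ x, |f x| * |g (j, k) x|) := by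
      refine Finset.sum_le_sum fun i _ => Finset.sum_le_sum fun j _ => ?_
      by_cases hij : i = j
      · subst hij; simp [sep_self]
      · exact lintegral_sq_div_norm_sep_le hd hij hf (fun k => hg (j, k)) fun k => hfg (j, k)
    _ = _ := by
      rw [ENNReal.ofReal_sum_of_nonneg fun i _ => Finset.sum_nonneg fun j _ => hI i j]
      refine Finset.sum_congr rfl fun i _ => ?_
      rw [ENNReal.ofReal_sum_of_nonneg fun j _ => hI i j]

end Hardy

/-! ### Symmetry of the Hamiltonian -/

section Symmetry

variable {d n : ℕ}

/-- As `V ≤ 0`, the `L²` norm of `(-V)^{1/2} f` is the square root of `∫ -V f²`. -/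
theorem eLpNorm_sqrt_potential_mul (f : Config d n → ℝ) :
    eLpNorm (fun x => √(-potential x) * f x) 2 volume =
      (∫⁻ x, ENNReal.ofReal (-potential x * f x ^ 2)) ^ (1 / (2 : ℝ)) := by
  rw [eLpNorm_eq_lintegral_rpow_enorm_toReal (by norm_num) (by norm_num)]
  norm_num
  congr 1
  refine lintegral_congr fun x => ?_
  rw [← enorm_mul, ← enorm_pow, mul_pow, Real.sq_sqrt (by linarith [potential_nonpos x]),
    Real.enorm_of_nonneg (by nlinarith [potential_nonpos x, sq_nonneg (f x)])]
  ring_nf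

theorem memLp_sqrt_potential_mul (hd : 2 ≤ d) {f : Config d n → ℝ} (hf : MemLp f 2)
    {g : Fin (n + 1) × Fin d → Config d n → ℝ} (hg : ∀ p, MemLp (g p) 2)
    (hfg : ∀ p, HasWeakDeriv volume f (g p) (dir p.1 p.2)) :
    MemLp (fun x => √(-potential x) * f x) 2 := by
  refine ⟨(measurable_potential.neg.sqrt.aemeasurable.mul hf.1.aemeasurable
    ).aestronglyMeasurable, ?_⟩
  rw [eLpNorm_sqrt_potential_mul]
  refine ENNReal.rpow_lt_top_of_nonneg (by norm_num) (ne_of_lt ?_)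
  exact (lintegral_potential_mul_sq_le hd hf hg hfg).trans_lt ENNReal.ofReal_lt_top

theorem hasWeakDeriv_of_test {η : Config d n → ℝ} (hη : ContDiff ℝ ∞ η) (u : Config d n) :
    HasWeakDeriv volume η (fun x => lineDeriv ℝ η x u) u := fun _ hζ hζc =>
  integral_mul_hasLineDerivAt_eq_neg (hζ.of_le (by simp)) hζc hη.continuous
    (contDiff_lineDeriv hη u).continuous fun x =>
      ((hη.differentiable (by simp) x).lineDifferentiableAt).hasLineDerivAt

theorem HasWeakDeriv.sub {f g f' g' : Config d n → ℝ} {u : Config d n}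
    (h : HasWeakDeriv volume f g u) (h' : HasWeakDeriv volume f' g' u) (hf : MemLp f 2)
    (hg : MemLp g 2) (hf' : MemLp f' 2) (hg' : MemLp g' 2) :
    HasWeakDeriv volume (fun x => f x - f' x) (fun x => g x - g' x) u := by
  intro η hη hc
  have hηL : MemLp η 2 := hη.continuous.memLp_of_hasCompactSupport hc
  have hηL' := memLp_lineDeriv_of_test hη hc u
  have key : ∀ {a b b' : Config d n → ℝ}, MemLp a 2 → MemLp b 2 → MemLp b' 2 →
      ∫ x, a x * (b x - b' x) = (∫ x, a x * b x) - ∫ x, a x * b' x := fun ha hb hb' => by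
    simp only [mul_sub]
    exact integral_sub (ha.integrable_mul hb) (ha.integrable_mul hb')
  rw [key hηL hg hg', key hηL' hf hf', h η hη hc, h' η hη hc]
  ring

/-- By the Hardy inequality, multiplication by `(-V)^{1/2}` is continuous from `H¹` to `L²`. -/
theorem tendsto_eLpNorm_sqrt_potential_mul (hd : 2 ≤ d) {f : Config d n → ℝ} (hf : MemLp f 2)
    {g : Fin (n + 1) × Fin d → Config d n → ℝ} (hg : ∀ p, MemLp (g p) 2)
    (hfg : ∀ p, HasWeakDeriv volume f (g p) (dir p.1 p.2)) {η : ℕ → Config d n → ℝ}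
    (hη : ∀ m, ContDiff ℝ ∞ (η m)) (hc : ∀ m, HasCompactSupport (η m))
    (hlim : Tendsto (fun m => eLpNorm (fun x => η m x - f x) 2 volume) atTop (𝓝 0))
    (hlim' : ∀ p : Fin (n + 1) × Fin d, Tendsto (fun m => eLpNorm
      (fun x => lineDeriv ℝ (η m) x (dir p.1 p.2) - g p x) 2 volume) atTop (𝓝 0)) :
    Tendsto (fun m => eLpNorm (fun x => √(-potential x) * η m x - √(-potential x) * f x) 2
      volume) atTop (𝓝 0) := by
  have hηL : ∀ m, MemLp (η m) 2 := fun m =>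
    (hη m).continuous.memLp_of_hasCompactSupport (hc m)
  have hηL' := fun m => memLp_lineDeriv_of_test (hη m) (hc m)
  have h1 : ∀ (p : Fin (n + 1) × Fin d), Tendsto (fun m => ∫ x, |η m x - f x| *
      |lineDeriv ℝ (η m) x (dir p.1 p.2) - g p x|) atTop (𝓝 0) := by
    intro p
    have := tendsto_integral_mul_of_tendsto_eLpNorm (F := fun m x => |η m x - f x|)
      (G := fun m x => |lineDeriv ℝ (η m) x (dir p.1 p.2) - g p x|) (f := fun _ => 0)
      (g := fun _ => 0) (fun m => ((hηL m).sub hf).abs) MemLp.zero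
      (fun m => ((hηL' m _).sub (hg p)).abs) MemLp.zero
      (by simpa using tendsto_eLpNorm_abs_sub (f := fun _ => 0) (by simpa using hlim))
      (by simpa using tendsto_eLpNorm_abs_sub (f := fun _ => 0) (by simpa using hlim' p))
    simpa using this
  have h2 : Tendsto (fun m => ∑ i : Fin (n + 1), ∑ j : Fin (n + 1), 2 * ∑ k, ∫ x, |η m x - f x| *
      |lineDeriv ℝ (η m) x (dir j k) - g (j, k) x|) atTop (𝓝 0) := by
    have := tendsto_finsetSum (Finset.univ : Finset (Fin (n + 1))) fun i _ =>
      tendsto_finsetSum (Finset.univ : Finset (Fin (n + 1))) fun j _ =>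
        (tendsto_finsetSum (Finset.univ : Finset (Fin d)) fun k _ => h1 (j, k)).const_mul 2
    simpa using this
  have h3 : Tendsto (fun m => ∫⁻ x, ENNReal.ofReal (-potential x * (η m x - f x) ^ 2)) atTop
      (𝓝 0) := by
    have h4 := ENNReal.tendsto_ofReal h2
    rw [ENNReal.ofReal_zero] at h4
    refine tendsto_of_tendsto_of_tendsto_of_le_of_le tendsto_const_nhds h4 (fun _ => zero_le)
      fun m => ?_
    exact lintegral_potential_mul_sq_le hd (f := fun x => η m x - f x)
      (g := fun p x => lineDeriv ℝ (η m) x (dir p.1 p.2) - g p x) ((hηL m).sub hf)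
      (fun p => (hηL' m _).sub (hg p)) fun p => (hasWeakDeriv_of_test (hη m) _).sub (hfg p) (hηL m) (hηL' m _) hf (hg p)
  have h5 := ((ENNReal.continuous_rpow_const (y := 1 / (2 : ℝ))).tendsto 0).comp h3
  rw [ENNReal.zero_rpow_of_pos (by norm_num)] at h5
  refine h5.congr fun m => ?_
  simp only [← mul_sub]
  rw [eLpNorm_sqrt_potential_mul]
  rfl

/-- The Hardy inequality for a bump function bounds the integral of the potential over a ball. -/
theorem locallyIntegrable_potential (hd : 2 ≤ d) :
    LocallyIntegrable (potential : Config d n → ℝ) := by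
  intro x
  let χ : ContDiffBump x := ⟨1, 2, one_pos, one_lt_two⟩
  have hχ : ContDiff ℝ ∞ χ := χ.contDiff
  have hL : MemLp χ 2 volume := hχ.continuous.memLp_of_hasCompactSupport χ.hasCompactSupport
  have key := (lintegral_potential_mul_sq_le hd hL
    (fun p => memLp_lineDeriv_of_test hχ χ.hasCompactSupport (dir p.1 p.2))
    (fun p => hasWeakDeriv_of_test hχ (dir p.1 p.2))).trans_lt ENNReal.ofReal_lt_top
  refine ⟨Metric.ball x 1, Metric.ball_mem_nhds x one_pos,
    measurable_potential.aestronglyMeasurable, ?_⟩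
  refine lt_of_le_of_lt ?_ key
  rw [← lintegral_indicator measurableSet_ball]
  refine lintegral_mono fun y => ?_
  by_cases hy : y ∈ Metric.ball x 1
  · rw [Set.indicator_of_mem hy, χ.one_of_mem_closedBall (Metric.ball_subset_closedBall hy),
      one_pow, mul_one, ← enorm_neg, Real.enorm_of_nonneg (by linarith [potential_nonpos y])]
  · rw [Set.indicator_of_notMem hy]; exact zero_le

/-- The real function `φ` is in the domain of the Hamiltonian and is mapped to `f`, up to the
local integrability of `Vφ`, which follows from `φ ∈ H¹` when `2 ≤ d`. -/
structure IsRealImage (φ f : Config d n → ℝ) : Prop where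
  memLp : MemLp φ 2
  memLp_image : MemLp f 2
  weakDeriv : ∀ u, ∃ g, MemLp g 2 ∧ HasWeakDeriv volume φ g u
  eq : ∀ η : Config d n → ℝ, ContDiff ℝ ∞ η → HasCompactSupport η →
    ∫ x, η x * f x = (∫ x, kinetic η x * φ x) + ∫ x, η x * (potential x * φ x)

/-- The quadratic form of the Hamiltonian: its defining equation extends from test functions to all
of `H¹`. -/
theorem IsRealImage.integral_mul_eq (hd : 2 ≤ d) {φ' f' : Config d n → ℝ} (h : IsRealImage φ' f')
    {g' : Fin (n + 1) × Fin d → Config d n → ℝ} (hg' : ∀ p, MemLp (g' p) 2)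
    (hfg' : ∀ p, HasWeakDeriv volume φ' (g' p) (dir p.1 p.2)) {φ : Config d n → ℝ}
    (hφ : MemLp φ 2) {g : Fin (n + 1) × Fin d → Config d n → ℝ} (hg : ∀ p, MemLp (g p) 2)
    (hfg : ∀ p, HasWeakDeriv volume φ (g p) (dir p.1 p.2)) :
    ∫ x, φ x * f' x = (∑ i, (1 / 2 : ℝ) * ∑ k, ∫ x, g (i, k) x * g' (i, k) x) -
      ∫ x, (√(-potential x) * φ x) * (√(-potential x) * φ' x) := by
  obtain ⟨η, hη, hc, hlim, hlim'⟩ :=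
    exists_test_approx hφ (fun p : Fin (n + 1) × Fin d => dir p.1 p.2) hg hfg
  have hηL : ∀ m, MemLp (η m) 2 := fun m =>
    (hη m).continuous.memLp_of_hasCompactSupport (hc m)
  have hV' := memLp_sqrt_potential_mul hd h.memLp hg' hfg'
  have hz : ∀ {F : Config d n → ℝ}, Tendsto (fun _ : ℕ => eLpNorm (fun x => F x - F x) 2 volume)
      atTop (𝓝 0) := fun {F} => by simp
  have htest : ∀ m, ∫ x, η m x * f' x =
      (∑ i, (1 / 2 : ℝ) * ∑ k, ∫ x, lineDeriv ℝ (η m) x (dir i k) * g' (i, k) x) -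
      ∫ x, (√(-potential x) * η m x) * (√(-potential x) * φ' x) := by
    intro m
    rw [h.eq _ (hη m) (hc m), sub_eq_add_neg, ← integral_neg]
    congr 1
    · have hint : ∀ i k, Integrable fun x => lineDeriv ℝ
          (fun y => lineDeriv ℝ (η m) y (dir i k)) x (dir i k) * φ' x := fun i k =>
        (memLp_lineDeriv_of_test (contDiff_lineDeriv (hη m) _)
          (hasCompactSupport_lineDeriv (hη m) (hc m) _) _).integrable_mul h.memLp
      simp only [kinetic, Finset.sum_mul, mul_assoc, Finset.mul_sum]
      rw [integral_finsetSum _ fun i _ => integrable_finsetSum _ fun k _ =>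
        (hint i k).const_mul _]
      refine Finset.sum_congr rfl fun i _ => ?_
      rw [integral_finsetSum _ fun k _ => (hint i k).const_mul _]
      refine Finset.sum_congr rfl fun k _ => ?_
      rw [integral_const_mul, hfg' (i, k) _ (contDiff_lineDeriv (hη m) _)
        (hasCompactSupport_lineDeriv (hη m) (hc m) _)]
      ring
    · refine integral_congr_ae (ae_of_all _ fun x => ?_)
      have := Real.mul_self_sqrt (show 0 ≤ -potential x by linarith [potential_nonpos x])
      linear_combination η m x * φ' x * this
  have t1 : Tendsto (fun m => ∫ x, η m x * f' x) atTop (𝓝 (∫ x, φ x * f' x)) :=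
    tendsto_integral_mul_of_tendsto_eLpNorm hηL hφ (fun _ => h.memLp_image) h.memLp_image hlim hz
  have t2 : Tendsto (fun m => ∫ x, (√(-potential x) * η m x) * (√(-potential x) * φ' x)) atTop
      (𝓝 (∫ x, (√(-potential x) * φ x) * (√(-potential x) * φ' x))) :=
    tendsto_integral_mul_of_tendsto_eLpNorm
      (fun m => memLp_sqrt_potential_mul hd (hηL m)
        (fun p => memLp_lineDeriv_of_test (hη m) (hc m) (dir p.1 p.2))
        (fun p => hasWeakDeriv_of_test (hη m) (dir p.1 p.2)))
      (memLp_sqrt_potential_mul hd hφ hg hfg) (fun _ => hV') hV'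
      (tendsto_eLpNorm_sqrt_potential_mul hd hφ hg hfg hη hc hlim hlim') hz
  have t3 : Tendsto (fun m => ∑ i, (1 / 2 : ℝ) * ∑ k, ∫ x, lineDeriv ℝ (η m) x (dir i k) *
      g' (i, k) x) atTop (𝓝 (∑ i, (1 / 2 : ℝ) * ∑ k, ∫ x, g (i, k) x * g' (i, k) x)) := by
    refine tendsto_finsetSum _ fun i _ => (tendsto_finsetSum _ fun k _ => ?_).const_mul _
    exact tendsto_integral_mul_of_tendsto_eLpNorm
      (fun m => memLp_lineDeriv_of_test (hη m) (hc m) _) (hg (i, k)) (fun _ => hg' (i, k))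
      (hg' (i, k)) (hlim' (i, k)) hz
  exact tendsto_nhds_unique (t1.congr htest) (t3.sub t2)

/-- The Hamiltonian is symmetric. -/
theorem IsRealImage.symm (hd : 2 ≤ d) {φ f φ' f' : Config d n → ℝ} (h : IsRealImage φ f)
    (h' : IsRealImage φ' f') : ∫ x, φ x * f' x = ∫ x, f x * φ' x := by
  choose g hg hfg using h.weakDeriv
  choose g' hg' hfg' using h'.weakDeriv
  rw [h'.integral_mul_eq hd (fun p => hg' (dir p.1 p.2)) (fun p => hfg' (dir p.1 p.2)) h.memLp
      (fun p => hg (dir p.1 p.2)) (fun p => hfg (dir p.1 p.2))]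
  simp only [mul_comm (f _)]
  rw [h.integral_mul_eq hd (fun p => hg (dir p.1 p.2)) (fun p => hfg (dir p.1 p.2)) h'.memLp
      (fun p => hg' (dir p.1 p.2)) (fun p => hfg' (dir p.1 p.2))]
  simp only [mul_comm]

end Symmetry

/-! ### Sums of unit vectors -/

section Geometry

variable {F : Type*} [NormedAddCommGroup F] [InnerProductSpace ℝ F]

/-- The sum of the cosines of the angles of a triangle is at least `1`. -/
theorem one_le_sum_cos {p q r : F} (hpq : p ≠ q) (hqr : q ≠ r) (hrp : r ≠ p) :
    1 ≤ inner ℝ (q - p) (r - p) / (‖q - p‖ * ‖r - p‖) +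
      inner ℝ (r - q) (p - q) / (‖r - q‖ * ‖p - q‖) +
      inner ℝ (p - r) (q - r) / (‖p - r‖ * ‖q - r‖) := by
  have law : ∀ a b c : F, inner ℝ (b - a) (c - a) =
      (‖b - a‖ ^ 2 + ‖c - a‖ ^ 2 - ‖c - b‖ ^ 2) / 2 := fun a b c => by
    have h := norm_sub_sq_real (c - a) (b - a)
    rw [sub_sub_sub_cancel_right, real_inner_comm] at h
    linarith
  rw [law p q r, law q r p, law r p q, norm_sub_rev p q, norm_sub_rev q r, norm_sub_rev p r]
  have h1 : 0 < ‖q - p‖ := norm_pos_iff.mpr (sub_ne_zero.mpr hpq.symm)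
  have h2 : 0 < ‖r - q‖ := norm_pos_iff.mpr (sub_ne_zero.mpr hqr.symm)
  have h3 : 0 < ‖r - p‖ := norm_pos_iff.mpr (sub_ne_zero.mpr hrp)
  have t1 : ‖r - p‖ ≤ ‖q - p‖ + ‖r - q‖ := by
    rw [add_comm]; exact norm_sub_le_norm_sub_add_norm_sub r q p
  have t2 : ‖q - p‖ ≤ ‖r - q‖ + ‖r - p‖ := by
    rw [norm_sub_rev r q]; exact norm_sub_le_norm_sub_add_norm_sub q r p
  have t3 : ‖r - q‖ ≤ ‖r - p‖ + ‖q - p‖ := by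
    rw [norm_sub_rev q p]; exact norm_sub_le_norm_sub_add_norm_sub r p q
  set a := ‖q - p‖
  set b := ‖r - q‖
  set c := ‖r - p‖
  -- Each factor on the right is non-negative by the triangle inequality.
  have key : (a ^ 2 + c ^ 2 - b ^ 2) / 2 / (a * c) + (b ^ 2 + a ^ 2 - c ^ 2) / 2 / (b * a) +
      (c ^ 2 + b ^ 2 - a ^ 2) / 2 / (c * b) - 1 =
      (a + b - c) * (b + c - a) * (c + a - b) / (2 * a * b * c) := by
    field_simp
    ring
  have : 0 ≤ (a + b - c) * (b + c - a) * (c + a - b) / (2 * a * b * c) :=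
    div_nonneg (mul_nonneg (mul_nonneg (by linarith) (by linarith)) (by linarith)) (by positivity)
  linarith

/-- For `N` distinct points, the sum over the points of the squared length of the sum of the unit
vectors to the other points is at least `N (N² - 1) / 3`. Expanding the squares gives a sum over
triples of points, of which each cyclic average is the sum of cosines of a triangle. -/
theorem le_sum_norm_sum_unit_sq {ι : Type*} [Fintype ι] {r : ι → F} (hr : Function.Injective r) :
    (Fintype.card ι : ℝ) * ((Fintype.card ι : ℝ) ^ 2 - 1) / 3 ≤
      ∑ i, ‖∑ j, ‖r j - r i‖⁻¹ • (r j - r i)‖ ^ 2 := by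
  classical
  let w : ι → ι → F := fun i j => ‖r j - r i‖⁻¹ • (r j - r i)
  let f : ι → ι → ι → ℝ := fun i j k => inner ℝ (w i j) (w i k)
  have hw : ∀ i, w i i = 0 := fun i => by simp [w]
  have hw1 : ∀ {i j}, i ≠ j → ‖w i j‖ = 1 := fun {i j} h => by
    have : ‖r j - r i‖ ≠ 0 := norm_ne_zero_iff.mpr (sub_ne_zero.mpr (hr.ne h.symm))
    simp [w, norm_smul, this]
  have hw2 : ∀ {i j}, i ≠ j → f i j j = 1 := fun {i j} h => by
    simp only [f]; rw [real_inner_self_eq_norm_sq, hw1 h, one_pow]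
  have hf : ∀ i j k, f i j k = inner ℝ (r j - r i) (r k - r i) / (‖r j - r i‖ * ‖r k - r i‖) :=
    fun i j k => by
      simp only [f, w, inner_smul_left, inner_smul_right, conj_trivial]
      rw [div_eq_mul_inv, mul_inv]; ring
  have hcyc : ∀ i j k, 1 - (if i = j ∧ j = k then (1 : ℝ) else 0) ≤
      f i j k + f j k i + f k i j := by
    intro i j k
    by_cases hij : i = j
    · subst hij
      by_cases hjk : i = k
      · subst hjk; simp [f, hw]
      · simp only [hjk, and_false, if_false, sub_zero]
        rw [show f i i k = 0 by simp [f, hw], show f i k i = 0 by simp [f, hw],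
          hw2 (Ne.symm hjk)]
        norm_num
    · simp only [hij, false_and, if_false, sub_zero]
      by_cases hjk : j = k
      · subst hjk
        rw [hw2 hij, show f j j i = 0 by simp [f, hw], show f j i j = 0 by simp [f, hw]]
        norm_num
      · by_cases hki : k = i
        · subst hki
          rw [show f k j k = 0 by simp [f, hw], show f k k j = 0 by simp [f, hw],
            hw2 (Ne.symm hij)]
          norm_num
        · rw [hf, hf, hf]
          exact one_le_sum_cos (hr.ne hij) (hr.ne hjk) (hr.ne hki)
  have hsum : ∑ i : ι, ∑ j : ι, ∑ k : ι, (1 - (if i = j ∧ j = k then (1 : ℝ) else 0)) ≤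
      ∑ i, ∑ j, ∑ k, (f i j k + f j k i + f k i j) :=
    Finset.sum_le_sum fun i _ => Finset.sum_le_sum fun j _ => Finset.sum_le_sum fun k _ =>
      hcyc i j k
  have e1 : ∑ i : ι, ∑ j : ι, ∑ k : ι, (1 - (if i = j ∧ j = k then (1 : ℝ) else 0)) =
      (Fintype.card ι : ℝ) ^ 3 - Fintype.card ι := by
    have : ∀ i : ι, ∑ j : ι, ∑ k : ι, (if i = j ∧ j = k then (1 : ℝ) else 0) = 1 := fun i => by
      simp [ite_and]
    simp only [Finset.sum_sub_distrib, this]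
    simp
    ring
  have e2 : ∑ i, ∑ j, ∑ k, f j k i = ∑ i, ∑ j, ∑ k, f i j k := by
    rw [Finset.sum_comm]
    exact Finset.sum_congr rfl fun j _ => Finset.sum_comm
  have e3 : ∑ i, ∑ j, ∑ k, f k i j = ∑ i, ∑ j, ∑ k, f i j k := by
    refine (Finset.sum_congr rfl fun i _ => Finset.sum_comm).trans ?_
    exact Finset.sum_comm
  have e4 : ∑ i, ‖∑ j, w i j‖ ^ 2 = ∑ i, ∑ j, ∑ k, f i j k := by
    refine Finset.sum_congr rfl fun i _ => ?_
    rw [← real_inner_self_eq_norm_sq, sum_inner]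
    exact Finset.sum_congr rfl fun j _ => inner_sum _ _ _
  simp only [Finset.sum_add_distrib] at hsum
  rw [e1, e2, e3] at hsum
  change _ ≤ ∑ i, ‖∑ j, w i j‖ ^ 2
  rw [e4]
  linarith

end Geometry

/-! ### The smoothed trial function -/

section Trial

variable {d n : ℕ}

/-- The trial function `exp(-c ∑_{i<j} r_ij)` with the distances smoothed at scale `ε`. The sum in
the exponent runs over all ordered pairs, whence the factor `1/2`; for `ε ≠ 0` the pairs `(i, i)`
contribute a constant factor. -/
noncomputable def trial (c ε : ℝ) (x : Config d n) : ℝ :=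
  Real.exp (-(c / 2) * ∑ i, ∑ j, regDist ε i j x)

/-- The logarithmic derivative of the trial function in the direction `u`, divided by `-c/2`. -/
noncomputable def trialSlope (ε : ℝ) (u x : Config d n) : ℝ :=
  ∑ i, ∑ j, inner ℝ (sep i j x) (sep i j u) / regDist ε i j x

/-- The `k`-th coordinate of the sum of the smoothed unit vectors from particle `l` to the other
particles. -/
noncomputable def pull (ε : ℝ) (l : Fin (n + 1)) (k : Fin d) (x : Config d n) : ℝ :=
  ∑ j, sep l j x k / regDist ε l j x

/-- The Laplacian of the smoothed distance of particle `l` to particle `j ≠ l`, in the position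
of particle `l`. -/
noncomputable def distLaplacian (ε : ℝ) (l j : Fin (n + 1)) (x : Config d n) : ℝ :=
  if j = l then 0 else d / regDist ε l j x - ‖sep l j x‖ ^ 2 / regDist ε l j x ^ 3

/-- The kinetic energy density of the smoothed trial function. -/
noncomputable def trialKinetic (c ε : ℝ) (x : Config d n) : ℝ :=
  trial c ε x * (-(c ^ 2 / 2) * (∑ l, ∑ k, pull ε l k x ^ 2) +
    c / 2 * ∑ l, ∑ j, distLaplacian ε l j x)

theorem regDist_nonneg (ε : ℝ) (i j : Fin (n + 1)) (x : Config d n) : 0 ≤ regDist ε i j x :=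
  Real.sqrt_nonneg _

theorem regDist_swap (ε : ℝ) (i j : Fin (n + 1)) (x : Config d n) :
    regDist ε j i x = regDist ε i j x := by
  rw [regDist, regDist, sep_swap i j, norm_neg]

theorem trial_pos (c ε : ℝ) (x : Config d n) : 0 < trial c ε x := Real.exp_pos _

theorem trial_le_one {c : ℝ} (hc : 0 ≤ c) (ε : ℝ) (x : Config d n) : trial c ε x ≤ 1 := by
  refine Real.exp_le_one_iff.mpr ?_
  have : 0 ≤ ∑ i, ∑ j, regDist ε i j x :=
    Finset.sum_nonneg fun i _ => Finset.sum_nonneg fun j _ => regDist_nonneg ε i j x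
  nlinarith

theorem continuous_trial (c ε : ℝ) : Continuous (trial c ε : Config d n → ℝ) :=
  Real.continuous_exp.comp (continuous_const.mul (continuous_finsetSum _ fun i _ =>
    continuous_finsetSum _ fun j _ => continuous_regDist ε i j))

theorem tendsto_trial (c : ℝ) {t : ℕ → ℝ} (ht : Tendsto t atTop (𝓝 0)) (x : Config d n) :
    Tendsto (fun m => trial c (t m) x) atTop (𝓝 (trial c 0 x)) := by
  have : Continuous fun ε => trial c ε x :=
    Real.continuous_exp.comp (continuous_const.mul (continuous_finsetSum _ fun i _ =>
      continuous_finsetSum _ fun j _ => continuous_regDist_left i j x))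
  exact (this.tendsto 0).comp ht

theorem hasLineDerivAt_trial (c : ℝ) {ε : ℝ} (hε : ε ≠ 0) (x u : Config d n) :
    HasLineDerivAt ℝ (trial c ε) (-(c / 2) * trialSlope ε u x * trial c ε x) x u := by
  have h1 : HasDerivAt (fun t : ℝ => -(c / 2) * ∑ i, ∑ j, regDist ε i j (x + t • u))
      (-(c / 2) * trialSlope ε u x) 0 :=
    (HasDerivAt.fun_sum fun i _ => HasDerivAt.fun_sum fun j _ =>
      hasLineDerivAt_regDist hε i j x u).const_mul _
  refine HasDerivAt.congr_deriv h1.exp ?_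
  simp only [zero_smul, add_zero, trial]
  ring

/-- Moving particle `l` changes `r_il` and `r_lj`, with opposite signs of the separations, so that
the two sums over ordered pairs agree. -/
theorem trialSlope_dir (ε : ℝ) (l : Fin (n + 1)) (k : Fin d) (x : Config d n) :
    trialSlope ε (dir l k) x = -2 * pull ε l k x := by
  have h1 : ∀ i j, inner ℝ (sep i j x) (sep i j (dir l k : Config d n)) / regDist ε i j x =
      (if j = l then sep i j x k / regDist ε i j x else 0) -
        (if i = l then sep i j x k / regDist ε i j x else 0) := by
    intro i j
    rw [sep_dir, inner_smul_right, EuclideanSpace.inner_single_right]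
    split_ifs <;> simp
    ring
  simp only [trialSlope, h1, Finset.sum_sub_distrib]
  have h2 : ∑ i, ∑ j, (if i = l then sep i j x k / regDist ε i j x else 0) = pull ε l k x := by
    rw [Finset.sum_comm]; simp [pull]
  have h3 : ∑ i, ∑ j, (if j = l then sep i j x k / regDist ε i j x else 0) = -pull ε l k x := by
    simp only [Finset.sum_ite_eq', Finset.mem_univ, if_true, pull, ← Finset.sum_neg_distrib]
    refine Finset.sum_congr rfl fun i _ => ?_
    rw [sep_swap l i, regDist_swap ε l i]
    simp [neg_div]
  rw [h2, h3]; ring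

theorem hasLineDerivAt_trial_dir (c : ℝ) {ε : ℝ} (hε : ε ≠ 0) (l : Fin (n + 1)) (k : Fin d)
    (x : Config d n) :
    HasLineDerivAt ℝ (trial c ε) (c * pull ε l k x * trial c ε x) x (dir l k) := by
  refine HasDerivAt.congr_deriv (hasLineDerivAt_trial c hε x (dir l k)) ?_
  rw [trialSlope_dir]; ring

theorem hasLineDerivAt_pull {ε : ℝ} (hε : ε ≠ 0) (l : Fin (n + 1)) (k : Fin d) (x : Config d n) :
    HasLineDerivAt ℝ (pull ε l k) (-∑ j, if j = l then 0 else
      (1 / regDist ε l j x - sep l j x k ^ 2 / regDist ε l j x ^ 3)) x (dir l k) := by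
  have h1 : HasDerivAt (fun t : ℝ => pull ε l k (x + t • dir l k)) _ 0 :=
    HasDerivAt.fun_sum fun j _ => hasLineDerivAt_sep_coord_div hε l j k x (dir l k)
  refine HasDerivAt.congr_deriv h1 ?_
  rw [← Finset.sum_neg_distrib]
  refine Finset.sum_congr rfl fun j _ => ?_
  rw [sep_dir, inner_smul_right, EuclideanSpace.inner_single_right]
  by_cases h : j = l
  · simp [h]
  · simp [h]; ring

/-- The second derivative of the smoothed trial function as particle `l` moves in the `k`-th
direction. -/
noncomputable def trialSecond (c ε : ℝ) (l : Fin (n + 1)) (k : Fin d) (x : Config d n) : ℝ :=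
  trial c ε x * (c ^ 2 * pull ε l k x ^ 2 - c * ∑ j, if j = l then 0 else
      (1 / regDist ε l j x - sep l j x k ^ 2 / regDist ε l j x ^ 3))

theorem hasLineDerivAt_trial_second (c : ℝ) {ε : ℝ} (hε : ε ≠ 0) (l : Fin (n + 1)) (k : Fin d)
    (x : Config d n) :
    HasLineDerivAt ℝ (fun x => c * pull ε l k x * trial c ε x) (trialSecond c ε l k x) x
      (dir l k) := by
  have h1 : HasDerivAt (fun t : ℝ => c * pull ε l k (x + t • dir l k) *
      trial c ε (x + t • dir l k)) _ 0 :=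
    (HasDerivAt.const_mul c (hasLineDerivAt_pull hε l k x)).mul
      (hasLineDerivAt_trial_dir c hε l k x)
  refine HasDerivAt.congr_deriv h1 ?_
  simp only [zero_smul, add_zero, trialSecond]
  ring

theorem sum_trialSecond (c ε : ℝ) (x : Config d n) :
    ∑ l, -(1 / 2 : ℝ) * ∑ k, trialSecond c ε l k x = trialKinetic c ε x := by
  have h1 : ∀ l : Fin (n + 1), ∑ k : Fin d, ∑ j, (if j = l then 0 else
      (1 / regDist ε l j x - sep l j x k ^ 2 / regDist ε l j x ^ 3)) =
      ∑ j, distLaplacian ε l j x := by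
    intro l
    rw [Finset.sum_comm]
    refine Finset.sum_congr rfl fun j _ => ?_
    by_cases h : j = l
    · simp [h, distLaplacian]
    · simp only [h, if_false, distLaplacian, Finset.sum_sub_distrib, EuclideanSpace.norm_sq_eq,
        Finset.sum_div]
      simp [div_eq_mul_inv]
  simp only [trialSecond, ← Finset.mul_sum, Finset.sum_sub_distrib, h1, trialKinetic]
  ring

theorem continuous_pull {ε : ℝ} (hε : ε ≠ 0) (l : Fin (n + 1)) (k : Fin d) :
    Continuous (pull ε l k : Config d n → ℝ) :=
  continuous_finsetSum _ fun j _ => continuous_sep_coord_div hε l j k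

theorem continuous_trialSecond (c : ℝ) {ε : ℝ} (hε : ε ≠ 0) (l : Fin (n + 1)) (k : Fin d) :
    Continuous (trialSecond c ε l k : Config d n → ℝ) := by
  refine (continuous_trial c ε).mul ((continuous_const.mul ((continuous_pull hε l k).pow 2)).sub
    (continuous_const.mul (continuous_finsetSum _ fun j _ => ?_)))
  by_cases h : j = l
  · simp only [h, if_true]; exact continuous_const
  · simp only [h, if_false]
    have h0 : ∀ x : Config d n, regDist ε l j x ≠ 0 := fun x => (regDist_pos hε l j x).ne'
    exact (continuous_const.div (continuous_regDist ε l j) h0).sub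
      (Continuous.div (by fun_prop) ((continuous_regDist ε l j).pow 3) fun x => pow_ne_zero 3 (h0 x))

/-- Two integrations by parts move the kinetic energy from the test function to the smoothed trial
function. -/
theorem integral_kinetic_mul_trial (c : ℝ) {ε : ℝ} (hε : ε ≠ 0) {η : Config d n → ℝ}
    (hη : ContDiff ℝ ∞ η) (hc : HasCompactSupport η) :
    ∫ x, kinetic η x * trial c ε x = ∫ x, η x * trialKinetic c ε x := by
  have h1 : ∀ l k, ∫ x, lineDeriv ℝ (fun y => lineDeriv ℝ η y (dir l k)) x (dir l k) *
      trial c ε x = ∫ x, η x * trialSecond c ε l k x := by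
    intro l k
    have a1 := integral_mul_hasLineDerivAt_eq_neg (μ := volume) (hη.of_le (by simp)) hc
      ((continuous_const.mul (continuous_pull hε l k)).mul (continuous_trial c ε))
      (continuous_trialSecond c hε l k) (hasLineDerivAt_trial_second c hε l k)
    have a2 := integral_mul_hasLineDerivAt_eq_neg (μ := volume)
      ((contDiff_lineDeriv hη (dir l k)).of_le (by simp))
      (hasCompactSupport_lineDeriv hη hc (dir l k)) (continuous_trial c ε)
      ((continuous_const.mul (continuous_pull hε l k)).mul (continuous_trial c ε))
      (hasLineDerivAt_trial_dir c hε l k)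
    rw [a1, a2, neg_neg]
  have i1 : ∀ l k, Integrable fun x => lineDeriv ℝ (fun y => lineDeriv ℝ η y (dir l k)) x
      (dir l k) * trial c ε x := fun l k =>
    ((contDiff_lineDeriv (contDiff_lineDeriv hη _) _).continuous.mul
      (continuous_trial c ε)).integrable_of_hasCompactSupport
        (hasCompactSupport_lineDeriv (contDiff_lineDeriv hη _)
          (hasCompactSupport_lineDeriv hη hc _) _).mul_right
  have i2 : ∀ l k, Integrable fun x => η x * trialSecond c ε l k x := fun l k =>
    (hη.continuous.mul (continuous_trialSecond c hε l k)).integrable_of_hasCompactSupport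
      hc.mul_right
  have e1 : ∀ x, kinetic η x * trial c ε x = ∑ l, ∑ k, -(1 / 2 : ℝ) * (lineDeriv ℝ
      (fun y => lineDeriv ℝ η y (dir l k)) x (dir l k) * trial c ε x) := fun x => by
    simp only [kinetic, Finset.sum_mul, Finset.mul_sum, mul_assoc]
  have e2 : ∀ x, η x * trialKinetic c ε x =
      ∑ l, ∑ k, -(1 / 2 : ℝ) * (η x * trialSecond c ε l k x) := fun x => by
    rw [← sum_trialSecond]
    simp only [Finset.mul_sum]
    exact Finset.sum_congr rfl fun l _ => Finset.sum_congr rfl fun k _ => by ring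
  simp only [e1, e2]
  rw [integral_finsetSum _ fun l _ => integrable_finsetSum _ fun k _ => (i1 l k).const_mul _,
    integral_finsetSum _ fun l _ => integrable_finsetSum _ fun k _ => (i2 l k).const_mul _]
  refine Finset.sum_congr rfl fun l _ => ?_
  rw [integral_finsetSum _ fun k _ => (i1 l k).const_mul _,
    integral_finsetSum _ fun k _ => (i2 l k).const_mul _]
  refine Finset.sum_congr rfl fun k _ => ?_
  rw [integral_const_mul, integral_const_mul, h1]

end Trial

/-! ### The trial function in the domain of the Hamiltonian -/

section TrialLimit

variable {d n : ℕ}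

/-- The local energy `Hψ/ψ` of the trial function `ψ` at points without collisions. -/
noncomputable def trialEnergy (c : ℝ) (x : Config d n) : ℝ :=
  -(c ^ 2 / 2) * ∑ l, ∑ k, pull 0 l k x ^ 2

theorem abs_pull_le (ε : ℝ) (l : Fin (n + 1)) (k : Fin d) (x : Config d n) :
    |pull ε l k x| ≤ n + 1 := by
  refine (Finset.abs_sum_le_sum_abs _ _).trans ?_
  refine (Finset.sum_le_sum fun j _ => abs_sep_coord_div_le ε l j k x).trans ?_
  simp

theorem sum_pull_sq_le (ε : ℝ) (x : Config d n) :
    ∑ l : Fin (n + 1), ∑ k, pull ε l k x ^ 2 ≤ (n + 1) * (d * (n + 1) ^ 2) := by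
  have : ∀ (l : Fin (n + 1)) (k : Fin d), pull ε l k x ^ 2 ≤ ((n : ℝ) + 1) ^ 2 := fun l k =>
    sq_le_sq' (by linarith [neg_abs_le (pull ε l k x), abs_pull_le ε l k x])
      ((le_abs_self _).trans (abs_pull_le ε l k x))
  refine (Finset.sum_le_sum fun l _ => Finset.sum_le_sum fun k _ => this l k).trans ?_
  simp

theorem abs_distLaplacian_le (hd : 1 ≤ d) (ε : ℝ) {l j : Fin (n + 1)} {x : Config d n}
    (hx : l ≠ j → sep l j x ≠ 0) : |distLaplacian ε l j x| ≤ d * ‖sep l j x‖⁻¹ := by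
  by_cases h : j = l
  · simp [distLaplacian, h]; positivity
  · have hr : 0 < ‖sep l j x‖ := norm_pos_iff.mpr (hx (Ne.symm h))
    have hle := norm_sep_le_regDist ε l j x
    have hρ : 0 < regDist ε l j x := hr.trans_le hle
    have hd' : (1 : ℝ) ≤ d := by exact_mod_cast hd
    have h1 : ‖sep l j x‖ ^ 2 / regDist ε l j x ^ 3 ≤ d / regDist ε l j x := by
      rw [div_le_div_iff₀ (pow_pos hρ 3) hρ]
      have : ‖sep l j x‖ ^ 2 ≤ regDist ε l j x ^ 2 := by gcongr
      have h3 : 0 < regDist ε l j x ^ 3 := by positivity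
      nlinarith
    have h2 : d / regDist ε l j x ≤ d * ‖sep l j x‖⁻¹ := by
      rw [← div_eq_mul_inv]; gcongr
    have h3 : 0 ≤ ‖sep l j x‖ ^ 2 / regDist ε l j x ^ 3 := by positivity
    rw [distLaplacian, if_neg h, abs_of_nonneg (by linarith)]
    linarith

/-- A bound uniform in `ε`, locally integrable in `x`, used to dominate the limit `ε → 0`. -/
theorem abs_trialKinetic_le (hd : 1 ≤ d) {c : ℝ} (hc : 0 ≤ c) (ε : ℝ) {x : Config d n}
    (hx : ∀ i j : Fin (n + 1), i ≠ j → sep i j x ≠ 0) :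
    |trialKinetic c ε x| ≤ c ^ 2 / 2 * ((n + 1) * (d * (n + 1) ^ 2)) - c * d * potential x := by
  have h1 : |∑ l, ∑ j, distLaplacian ε l j x| ≤ d * ∑ l, ∑ j, ‖sep l j x‖⁻¹ := by
    rw [Finset.mul_sum]
    refine (Finset.abs_sum_le_sum_abs _ _).trans (Finset.sum_le_sum fun l _ => ?_)
    rw [Finset.mul_sum]
    exact (Finset.abs_sum_le_sum_abs _ _).trans (Finset.sum_le_sum fun j _ =>
      abs_distLaplacian_le hd ε (hx l j))
  have h2 := sum_pull_sq_le ε x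
  have h3 : 0 ≤ ∑ l, ∑ k, pull ε l k x ^ 2 := by positivity
  rw [trialKinetic, abs_mul, abs_of_pos (trial_pos c ε x)]
  refine (mul_le_of_le_one_left (abs_nonneg _) (trial_le_one hc ε x)).trans ?_
  refine (abs_add_le _ _).trans ?_
  rw [abs_mul, abs_mul, abs_neg, abs_of_nonneg (show 0 ≤ c ^ 2 / 2 by positivity),
    abs_of_nonneg (show 0 ≤ c / 2 by positivity), abs_of_nonneg h3, potential_eq]
  have h4 := mul_le_mul_of_nonneg_left h1 (show 0 ≤ c / 2 by positivity)
  have h5 := mul_le_mul_of_nonneg_left h2 (show 0 ≤ c ^ 2 / 2 by positivity)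
  linarith

/-- For `c = 1/(d - 1)` the singular part of the kinetic energy density of the trial function
cancels its potential energy density. -/
theorem trialKinetic_zero {c : ℝ} (hc : c * ((d : ℝ) - 1) = 1) (x : Config d n) :
    trialKinetic c 0 x = trial c 0 x * (trialEnergy c x - potential x) := by
  have h1 : ∀ l j : Fin (n + 1), distLaplacian 0 l j x = ((d : ℝ) - 1) * ‖sep l j x‖⁻¹ := by
    intro l j
    by_cases h : j = l
    · subst h; simp [distLaplacian, sep_self]
    · rw [distLaplacian, if_neg h, regDist_zero]
      by_cases h0 : ‖sep l j x‖ = 0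
      · simp [h0]
      · field_simp
  simp only [trialKinetic, h1, ← Finset.mul_sum, trialEnergy, potential_eq]
  linear_combination (trial c 0 x * (∑ i, ∑ j, ‖sep i j x‖⁻¹) / 2) * hc

theorem tendsto_regDist {t : ℕ → ℝ} (ht : Tendsto t atTop (𝓝 0)) (i j : Fin (n + 1))
    (x : Config d n) : Tendsto (fun m => regDist (t m) i j x) atTop (𝓝 (regDist 0 i j x)) :=
  ((continuous_regDist_left i j x).tendsto 0).comp ht

theorem tendsto_trialKinetic (c : ℝ) {t : ℕ → ℝ} (ht : Tendsto t atTop (𝓝 0)) {x : Config d n}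
    (hx : ∀ i j : Fin (n + 1), i ≠ j → sep i j x ≠ 0) :
    Tendsto (fun m => trialKinetic c (t m) x) atTop (𝓝 (trialKinetic c 0 x)) := by
  have h0 : ∀ {l j : Fin (n + 1)}, j ≠ l → regDist 0 l j x ≠ 0 := fun {l j} h => by
    rw [regDist_zero]; exact norm_ne_zero_iff.mpr (hx l j (Ne.symm h))
  refine (tendsto_trial c ht x).mul (((tendsto_finsetSum _ fun l _ => tendsto_finsetSum _
    fun k _ => Tendsto.pow (tendsto_finsetSum _ fun j _ => ?_) 2).const_mul _).add
    ((tendsto_finsetSum _ fun l _ => tendsto_finsetSum _ fun j _ => ?_).const_mul _))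
  · by_cases h : j = l
    · subst h; simp [sep_self]
    · exact tendsto_const_nhds.div (tendsto_regDist ht l j x) (h0 h)
  · by_cases h : j = l
    · simp [distLaplacian, h]
    · simp only [distLaplacian, h, if_false]
      exact (tendsto_const_nhds.div (tendsto_regDist ht l j x) (h0 h)).sub
        (tendsto_const_nhds.div ((tendsto_regDist ht l j x).pow 3) (pow_ne_zero 3 (h0 h)))

theorem measurable_pull (ε : ℝ) (l : Fin (n + 1)) (k : Fin d) :
    Measurable (pull ε l k : Config d n → ℝ) := by
  refine Finset.measurable_sum _ fun j _ => ?_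
  have : Continuous fun x : Config d n => sep l j x k := by fun_prop
  exact this.measurable.div (continuous_regDist ε l j).measurable

theorem measurable_trialEnergy (c : ℝ) : Measurable (trialEnergy c : Config d n → ℝ) :=
  (Finset.measurable_sum _ fun l _ => Finset.measurable_sum _ fun k _ =>
    (measurable_pull 0 l k).pow_const 2).const_mul _

theorem abs_trialEnergy_le (c : ℝ) (x : Config d n) :
    |trialEnergy c x| ≤ c ^ 2 / 2 * ((n + 1) * (d * (n + 1) ^ 2)) := by
  have h3 : 0 ≤ ∑ l, ∑ k, pull 0 l k x ^ 2 := by positivity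
  rw [trialEnergy, abs_mul, abs_neg, abs_of_nonneg (show 0 ≤ c ^ 2 / 2 by positivity),
    abs_of_nonneg h3]
  exact mul_le_mul_of_nonneg_left (sum_pull_sq_le 0 x) (by positivity)

theorem measurable_trialSlope (ε : ℝ) (u : Config d n) : Measurable (trialSlope ε u) := by
  refine Finset.measurable_sum _ fun i _ => Finset.measurable_sum _ fun j _ => ?_
  have : Continuous fun x : Config d n => (inner ℝ (sep i j x) (sep i j u) : ℝ) := by fun_prop
  exact this.measurable.div (continuous_regDist ε i j).measurable

theorem abs_trialSlope_le (ε : ℝ) (u x : Config d n) :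
    |trialSlope ε u x| ≤ ∑ i, ∑ j, ‖sep i j u‖ := by
  refine (Finset.abs_sum_le_sum_abs _ _).trans (Finset.sum_le_sum fun i _ => ?_)
  refine (Finset.abs_sum_le_sum_abs _ _).trans (Finset.sum_le_sum fun j _ => ?_)
  rw [abs_div, abs_of_nonneg (regDist_nonneg ε i j x)]
  refine div_le_of_le_mul₀ (regDist_nonneg ε i j x) (norm_nonneg _) ?_
  refine (abs_real_inner_le_norm _ _).trans ?_
  rw [mul_comm]
  exact mul_le_mul_of_nonneg_left (norm_sep_le_regDist ε i j x) (norm_nonneg _)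

theorem continuous_trialSlope {ε : ℝ} (hε : ε ≠ 0) (u : Config d n) :
    Continuous (trialSlope ε u) :=
  continuous_finsetSum _ fun i _ => continuous_finsetSum _ fun j _ =>
    Continuous.div (by fun_prop) (continuous_regDist ε i j) fun x => (regDist_pos hε i j x).ne'

theorem tendsto_trialSlope {t : ℕ → ℝ} (ht : Tendsto t atTop (𝓝 0)) (u : Config d n)
    {x : Config d n} (hx : ∀ i j : Fin (n + 1), i ≠ j → sep i j x ≠ 0) :
    Tendsto (fun m => trialSlope (t m) u x) atTop (𝓝 (trialSlope 0 u x)) := by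
  refine tendsto_finsetSum _ fun i _ => tendsto_finsetSum _ fun j _ => ?_
  by_cases h : i = j
  · subst h; simp [sep_self]
  · exact tendsto_const_nhds.div (tendsto_regDist ht i j x) (by
      rw [regDist_zero]; exact norm_ne_zero_iff.mpr (hx i j h))

theorem integrable_exp_neg_mul_norm {E : Type*} [NormedAddCommGroup E] [NormedSpace ℝ E]
    [FiniteDimensional ℝ E] [MeasurableSpace E] [BorelSpace E] (μ : Measure E) [μ.IsAddHaarMeasure]
    {a : ℝ} (ha : 0 < a) : Integrable (fun x : E => Real.exp (-a * ‖x‖)) μ := by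
  set D : ℕ := Module.finrank ℝ E + 1
  have hD : (Module.finrank ℝ E : ℝ) < (D : ℕ) := by exact_mod_cast Nat.lt_succ_self _
  have h1 := integrable_one_add_norm (μ := μ) hD
  refine (h1.const_mul (Real.exp a * (D.factorial / a ^ D))).mono'
    (by fun_prop) (ae_of_all _ fun x => ?_)
  rw [Real.norm_of_nonneg (Real.exp_pos _).le, Real.rpow_neg (by positivity), Real.rpow_natCast]
  have h2 := Real.pow_div_factorial_le_exp (x := a * (1 + ‖x‖)) (by positivity) D
  have h3 : Real.exp (-a * ‖x‖) = Real.exp a * (Real.exp (a * (1 + ‖x‖)))⁻¹ := by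
    rw [← Real.exp_neg, ← Real.exp_add]; ring_nf
  rw [h3, mul_assoc]
  refine mul_le_mul_of_nonneg_left ?_ (Real.exp_pos _).le
  have h4 : 0 < (a * (1 + ‖x‖)) ^ D / D.factorial := by positivity
  refine (inv_anti₀ h4 h2).trans (le_of_eq ?_)
  rw [mul_pow, inv_div]
  field_simp

/-- The trial function decays exponentially. -/
theorem trial_zero_le {c : ℝ} (hc : 0 ≤ c) (x : Config d n) :
    trial c 0 x ≤ Real.exp (-(c / 2) * ‖x‖) := by
  refine Real.exp_le_exp.mpr ?_
  have h1 : ‖x‖ ≤ ∑ i, ∑ j, regDist 0 i j x := by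
    have h2 : ‖x‖ ≤ ∑ j : Fin n, ‖x j‖ := by
      refine (sq_le_sq₀ (norm_nonneg _) (Finset.sum_nonneg fun j _ => norm_nonneg _)).mp ?_
      rw [PiLp.norm_sq_eq_of_L2]
      exact Finset.sum_sq_le_sq_sum_of_nonneg fun j _ => norm_nonneg _
    have h3 : ∑ j : Fin n, ‖x j‖ ≤ ∑ j, regDist 0 0 j x := by
      rw [Fin.sum_univ_succ]
      refine le_add_of_nonneg_of_le (regDist_nonneg _ _ _ _) (Finset.sum_le_sum fun j _ => ?_)
      rw [regDist_zero, sep_apply]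
      simp [pos]
    refine h2.trans (h3.trans ?_)
    exact Finset.single_le_sum (f := fun i => ∑ j, regDist 0 i j x)
      (fun i _ => Finset.sum_nonneg fun j _ => regDist_nonneg 0 i j x) (Finset.mem_univ 0)
  nlinarith

theorem memLp_trial {c : ℝ} (hc : 0 < c) : MemLp (trial c 0 : Config d n → ℝ) 2 := by
  rw [memLp_two_iff_integrable_sq (continuous_trial c 0).aestronglyMeasurable]
  refine (integrable_exp_neg_mul_norm volume hc).mono'
    ((continuous_trial c 0).pow 2).aestronglyMeasurable (ae_of_all _ fun x => ?_)
  rw [Real.norm_of_nonneg (sq_nonneg _)]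
  calc trial c 0 x ^ 2 ≤ Real.exp (-(c / 2) * ‖x‖) ^ 2 :=
        pow_le_pow_left₀ (trial_pos c 0 x).le (trial_zero_le hc.le x) 2
    _ = _ := by rw [← Real.exp_nat_mul]; congr 1; push_cast; ring

theorem memLp_bounded_mul_trial {c : ℝ} (hc : 0 < c) {w : Config d n → ℝ} (hw : Measurable w)
    {C : ℝ} (hC : ∀ x, |w x| ≤ C) : MemLp (fun x => w x * trial c 0 x) 2 := by
  refine MemLp.of_le_mul (c := C) (memLp_trial hc)
    (hw.mul (continuous_trial c 0).measurable).aestronglyMeasurable (ae_of_all _ fun x => ?_)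
  rw [norm_mul]
  exact mul_le_mul_of_nonneg_right (hC x) (norm_nonneg _)

theorem hasWeakDeriv_trial (hd : 0 < d) {c : ℝ} (hc : 0 ≤ c) (u : Config d n) :
    HasWeakDeriv volume (trial c 0) (fun x => -(c / 2) * trialSlope 0 u x * trial c 0 x) u := by
  intro η hη hηc
  let t : ℕ → ℝ := fun m => 1 / ((m : ℝ) + 1)
  have ht : Tendsto t atTop (𝓝 0) := tendsto_one_div_add_atTop_nhds_zero_nat
  have ht0 : ∀ m, t m ≠ 0 := fun m => by positivity
  have hηL := contDiff_lineDeriv hη u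
  have hηLc := hasCompactSupport_lineDeriv hη hηc u
  have hS : ∀ m, Continuous fun x : Config d n =>
      -(c / 2) * trialSlope (t m) u x * trial c (t m) x := fun m =>
    (continuous_const.mul (continuous_trialSlope (ht0 m) u)).mul (continuous_trial c _)
  have l1 : Tendsto (fun m => ∫ x, η x * (-(c / 2) * trialSlope (t m) u x * trial c (t m) x)) atTop
      (𝓝 (∫ x, η x * (-(c / 2) * trialSlope 0 u x * trial c 0 x))) := by
    refine tendsto_integral_of_dominated_convergence
      (fun x => |η x| * (c / 2 * ∑ i, ∑ j, ‖sep i j u‖))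
      (fun m => (hη.continuous.mul (hS m)).aestronglyMeasurable)
      (((hη.continuous.integrable_of_hasCompactSupport hηc).abs).mul_const _)
      (fun m => ae_of_all _ fun x => ?_) ?_
    · rw [Real.norm_eq_abs, abs_mul, abs_mul, abs_mul, abs_neg,
        abs_of_nonneg (show 0 ≤ c / 2 by positivity), abs_of_pos (trial_pos _ _ _)]
      refine mul_le_mul_of_nonneg_left ?_ (abs_nonneg _)
      refine (mul_le_of_le_one_right (by positivity) (trial_le_one hc _ x)).trans ?_
      exact mul_le_mul_of_nonneg_left (abs_trialSlope_le _ u x) (by positivity)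
    · filter_upwards [ae_forall_sep_ne_zero (n := n) hd] with x hx
      exact (((tendsto_trialSlope ht u hx).const_mul _).mul (tendsto_trial c ht x)).const_mul _
  have l2 : Tendsto (fun m => -∫ x, lineDeriv ℝ η x u * trial c (t m) x) atTop
      (𝓝 (-∫ x, lineDeriv ℝ η x u * trial c 0 x)) := by
    refine (tendsto_integral_of_dominated_convergence (fun x => |lineDeriv ℝ η x u|)
      (fun m => (hηL.continuous.mul (continuous_trial c _)).aestronglyMeasurable)
      (hηL.continuous.integrable_of_hasCompactSupport hηLc).abs
      (fun m => ae_of_all _ fun x => ?_) (ae_of_all _ fun x => ?_)).neg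
    · rw [Pi.mul_apply, Real.norm_eq_abs, abs_mul, abs_of_pos (trial_pos _ _ _)]
      exact mul_le_of_le_one_right (abs_nonneg _) (trial_le_one hc _ x)
    · exact (tendsto_trial c ht x).const_mul _
  refine tendsto_nhds_unique l1 (l2.congr fun m => ?_)
  exact (integral_mul_hasLineDerivAt_eq_neg (hη.of_le (by simp)) hηc (continuous_trial c _) (hS m)
    fun x => hasLineDerivAt_trial c (ht0 m) x u).symm

theorem integrable_test_mul_potential_mul_trial (hd : 2 ≤ d) {c : ℝ} {η : Config d n → ℝ}
    (hη : Continuous η) (hηc : HasCompactSupport η) :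
    Integrable fun x => η x * (potential x * trial c 0 x) := by
  have := (locallyIntegrable_potential (n := n) hd).integrable_smul_left_of_hasCompactSupport
    (hη.mul (continuous_trial c 0)) hηc.mul_right
  refine this.congr (ae_of_all _ fun x => ?_)
  simp only [Pi.mul_apply, smul_eq_mul]
  ring

/-- The trial function is in the domain of the Hamiltonian, which acts on it as multiplication by
the local energy. -/
theorem isRealImage_trial (hd : 2 ≤ d) {c : ℝ} (hc : c * ((d : ℝ) - 1) = 1) :
    IsRealImage (trial c 0 : Config d n → ℝ) (fun x => trialEnergy c x * trial c 0 x) := by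
  have hd' : (2 : ℝ) ≤ d := by exact_mod_cast hd
  have hc0 : 0 < c := pos_of_mul_pos_left (by rw [hc]; exact one_pos) (by linarith)
  refine ⟨memLp_trial hc0, memLp_bounded_mul_trial hc0 (measurable_trialEnergy c)
    (abs_trialEnergy_le c), fun u => ⟨_, memLp_bounded_mul_trial hc0
      (w := fun x => -(c / 2) * trialSlope 0 u x) ((measurable_trialSlope 0 u).const_mul _)
      (C := c / 2 * ∑ i, ∑ j, ‖sep i j u‖) fun x => ?_,
      hasWeakDeriv_trial (by omega) hc0.le u⟩, fun η hη hηc => ?_⟩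
  · rw [abs_mul, abs_neg, abs_of_pos (by positivity)]
    exact mul_le_mul_of_nonneg_left (abs_trialSlope_le _ u x) (by positivity)
  let t : ℕ → ℝ := fun m => 1 / ((m : ℝ) + 1)
  have ht : Tendsto t atTop (𝓝 0) := tendsto_one_div_add_atTop_nhds_zero_nat
  have ht0 : ∀ m, t m ≠ 0 := fun m => by positivity
  have hK : ∀ m, Continuous (trialKinetic c (t m) : Config d n → ℝ) := fun m => by
    have : (trialKinetic c (t m) : Config d n → ℝ) =
        fun x => ∑ l, -(1 / 2 : ℝ) * ∑ k, trialSecond c (t m) l k x :=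
      funext fun x => (sum_trialSecond c (t m) x).symm
    rw [this]
    exact continuous_finsetSum _ fun l _ => continuous_const.mul
      (continuous_finsetSum _ fun k _ => continuous_trialSecond c (ht0 m) l k)
  have hkin := continuous_kinetic hη
  have hkinc := hasCompactSupport_kinetic hηc
  have l1 : Tendsto (fun m => ∫ x, kinetic η x * trial c (t m) x) atTop
      (𝓝 (∫ x, kinetic η x * trial c 0 x)) := by
    refine tendsto_integral_of_dominated_convergence (fun x => |kinetic η x|)
      (fun m => (hkin.mul (continuous_trial c _)).aestronglyMeasurable)
      (hkin.integrable_of_hasCompactSupport hkinc).abs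
      (fun m => ae_of_all _ fun x => ?_) (ae_of_all _ fun x => ?_)
    · rw [Real.norm_eq_abs, abs_mul, abs_of_pos (trial_pos _ _ _)]
      exact mul_le_of_le_one_right (abs_nonneg _) (trial_le_one hc0.le _ x)
    · exact (tendsto_trial c ht x).const_mul _
  have l2 : Tendsto (fun m => ∫ x, η x * trialKinetic c (t m) x) atTop
      (𝓝 (∫ x, η x * trialKinetic c 0 x)) := by
    refine tendsto_integral_of_dominated_convergence
      (fun x => |η x| * (c ^ 2 / 2 * ((n + 1) * (d * (n + 1) ^ 2))) -
        c * d * (|η x| * potential x))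
      (fun m => (hη.continuous.mul (hK m)).aestronglyMeasurable) ?_
      (fun m => ?_) ?_
    · refine Integrable.sub
        (((hη.continuous.integrable_of_hasCompactSupport hηc).abs).mul_const _)
        (Integrable.const_mul ?_ _)
      exact (locallyIntegrable_potential hd).integrable_smul_left_of_hasCompactSupport
        hη.continuous.abs (hηc.comp_left abs_zero)
    · filter_upwards [ae_forall_sep_ne_zero (n := n) (by omega : 0 < d)] with x hx
      rw [Real.norm_eq_abs, abs_mul]
      refine (mul_le_mul_of_nonneg_left (abs_trialKinetic_le (by omega) hc0.le (t m) hx)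
        (abs_nonneg _)).trans (le_of_eq (by ring))
    · filter_upwards [ae_forall_sep_ne_zero (n := n) (by omega : 0 < d)] with x hx
      exact (tendsto_trialKinetic c ht hx).const_mul _
  -- The identity for the smoothed trial functions passes to the limit `ε → 0` on both sides.
  have hlim := tendsto_nhds_unique l1
    (l2.congr fun m => (integral_kinetic_mul_trial c (ht0 m) hη hηc).symm)
  rw [hlim, ← integral_add]
  · refine integral_congr_ae (ae_of_all _ fun x => ?_)
    simp only [trialKinetic_zero hc]
    ring
  · have i1 : Integrable fun x => η x * (trialEnergy c x * trial c 0 x) :=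
      (hη.continuous.memLp_of_hasCompactSupport (p := 2) hηc).integrable_mul
        (memLp_bounded_mul_trial hc0 (measurable_trialEnergy c) (abs_trialEnergy_le c))
    refine (i1.sub (integrable_test_mul_potential_mul_trial hd (c := c) hη.continuous hηc)).congr
      (ae_of_all _ fun x => ?_)
    simp only [Pi.sub_apply, trialKinetic_zero hc]
    ring
  · exact integrable_test_mul_potential_mul_trial hd hη.continuous hηc

theorem pos_injective {x : Config d n} (hx : ∀ i j : Fin (n + 1), i ≠ j → sep i j x ≠ 0) :
    Function.Injective (pos x) := fun i j h => by
  by_contra hij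
  exact hx i j hij (by rw [sep_apply, h, sub_self])

/-- The upper bound on the local energy off the collisions; the number of particles is `n + 1`. -/
theorem trialEnergy_le (c : ℝ) {x : Config d n}
    (hx : ∀ i j : Fin (n + 1), i ≠ j → sep i j x ≠ 0) :
    trialEnergy c x ≤ -(c ^ 2 * (((n : ℝ) + 1) * (((n : ℝ) + 1) ^ 2 - 1) / 6)) := by
  have h1 := le_sum_norm_sum_unit_sq (pos_injective hx)
  have h2 : ∀ l : Fin (n + 1), ‖∑ j, ‖pos x j - pos x l‖⁻¹ • (pos x j - pos x l)‖ ^ 2 =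
      ∑ k, pull 0 l k x ^ 2 := by
    intro l
    rw [EuclideanSpace.norm_sq_eq]
    refine Finset.sum_congr rfl fun k _ => ?_
    rw [Real.norm_eq_abs, sq_abs, pull]
    simp [regDist_zero, sep_apply, div_eq_inv_mul]
  simp only [h2, Fintype.card_fin] at h1
  push_cast at h1
  rw [trialEnergy]
  nlinarith [sq_nonneg c, mul_le_mul_of_nonneg_left h1 (sq_nonneg c)]

end TrialLimit

/-! ### The variational principle -/

section Abstract

variable {E : Type*} [NormedAddCommGroup E] [InnerProductSpace ℂ E] [CompleteSpace E]

/-- The variational principle: a symmetric operator with an expectation value `≤ B` has a point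
`≤ B` in its spectrum. Otherwise the inverse `R` of `A - B` is self-adjoint, and has no negative
point `s` in its spectrum, as `A - (B + 1/s)` is invertible; so `R ≥ 0`, which contradicts
`⟪Rf, f⟫ ≤ 0` for `f = (A - B) ψ`. -/
theorem exists_le_not_isResolventPoint {A : E →ₗ.[ℂ] E}
    (hA : ∀ φ ψ : A.domain, (inner ℂ (A φ) (ψ : E) : ℂ) = inner ℂ (φ : E) (A ψ)) {B : ℝ}
    {ψ : A.domain} (hψ : (ψ : E) ≠ 0)
    (hB : (inner ℂ (ψ : E) (A ψ) : ℂ).re ≤ B * ‖(ψ : E)‖ ^ 2) :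
    ∃ e ≤ B, ¬ IsResolventPoint A (e : ℂ) := by
  by_contra! h
  obtain ⟨R, hR, hR'⟩ := h B le_rfl
  have hsymm : ∀ f g, (inner ℂ (R f) g : ℂ) = inner ℂ f (R g) := by
    intro f g
    obtain ⟨hf, ef⟩ := hR f
    obtain ⟨hg, eg⟩ := hR g
    conv_lhs => rw [← eg]
    conv_rhs => rw [← ef]
    have hA' : (inner ℂ (A ⟨R f, hf⟩) (R g) : ℂ) = inner ℂ (R f) (A ⟨R g, hg⟩) :=
      hA ⟨R f, hf⟩ ⟨R g, hg⟩
    rw [inner_sub_left, inner_sub_right, hA', inner_smul_left, inner_smul_right]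
    simp
  have hsa : IsSelfAdjoint R := by
    rw [ContinuousLinearMap.isSelfAdjoint_iff_isSymmetric]
    exact hsymm
  have hspec : ∀ s ∈ spectrum ℝ R, 0 ≤ s := by
    intro s hs
    by_contra! hs0
    refine hs ?_
    have hsC : (s : ℂ) ≠ 0 := by exact_mod_cast hs0.ne
    obtain ⟨Q, hQ, hQ'⟩ := h (B + s⁻¹) (by linarith [inv_lt_zero.mpr hs0])
    push_cast at hQ hQ'
    -- `S` is the inverse of `s - R`, as `A - (B + 1/s)` composed with `R` is `(s - R)/s`.
    let S : E →L[ℂ] E := (s : ℂ)⁻¹ • (1 + (s : ℂ)⁻¹ • Q)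
    have hT : ∀ f, (algebraMap ℝ (E →L[ℂ] E) s - R) f = (s : ℂ) • f - R f := fun f => by
      rw [Algebra.algebraMap_eq_smul_one]; simp
    have hS : ∀ f, S f = (s : ℂ)⁻¹ • (f + (s : ℂ)⁻¹ • Q f) := fun f => by simp [S]
    refine ⟨⟨algebraMap ℝ (E →L[ℂ] E) s - R, S, ?_, ?_⟩, rfl⟩
    · ext f
      obtain ⟨hf, ef⟩ := hQ f
      have ef' := sub_eq_iff_eq_add.mp ef
      have h1 : S f = (s : ℂ)⁻¹ • (A ⟨Q f, hf⟩ - (B : ℂ) • Q f) := by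
        rw [hS, ef']; module
      have h2 := hR' ⟨Q f, hf⟩
      change (algebraMap ℝ (E →L[ℂ] E) s - R) (S f) = f
      rw [hT, h1, map_smul, h2, smul_smul, mul_inv_cancel₀ hsC, one_smul, ef']
      module
    · ext f
      obtain ⟨hf, ef⟩ := hR f
      change S ((algebraMap ℝ (E →L[ℂ] E) s - R) f) = f
      have h1 : (algebraMap ℝ (E →L[ℂ] E) s - R) f =
          (s : ℂ) • (A ⟨R f, hf⟩ - ((B : ℂ) + (s : ℂ)⁻¹) • R f) := by
        have : A ⟨R f, hf⟩ - ((B : ℂ) + (s : ℂ)⁻¹) • R f = f - (s : ℂ)⁻¹ • R f := by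
          rw [sub_eq_iff_eq_add.mp ef]; module
        rw [hT, this, smul_sub, smul_smul, mul_inv_cancel₀ hsC, one_smul]
      have h2 := hQ' ⟨R f, hf⟩
      rw [hS, h1, map_smul, h2, ← h1, hT, smul_smul, inv_mul_cancel₀ hsC, one_smul,
        sub_add_cancel, smul_smul, inv_mul_cancel₀ hsC, one_smul]
  have hR0 : 0 ≤ R := by
    rw [StarOrderedRing.nonneg_iff_spectrum_nonneg (R := ℝ) R hsa]
    exact hspec
  obtain ⟨T, hT⟩ := CStarAlgebra.nonneg_iff_eq_star_mul_self.mp hR0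
  set f : E := A ψ - (B : ℂ) • (ψ : E) with hf
  have hRf : R f = ψ := hR' ψ
  have hle : (inner ℂ (R f) f : ℂ).re ≤ 0 := by
    rw [hRf, hf, inner_sub_right, inner_smul_right, inner_self_eq_norm_sq_to_K, Complex.sub_re,
      Complex.re_ofReal_mul]
    norm_cast
    exact sub_nonpos.mpr hB
  have hTf : (inner ℂ (R f) f : ℂ).re = ‖T f‖ ^ 2 := by
    rw [hT]
    change (inner ℂ ((ContinuousLinearMap.adjoint T) (T f)) f : ℂ).re = _
    rw [ContinuousLinearMap.adjoint_inner_left, inner_self_eq_norm_sq_to_K]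
    norm_cast
  have h0 : T f = 0 := by
    have : ‖T f‖ ^ 2 ≤ 0 := hTf ▸ hle
    exact norm_eq_zero.mp (pow_eq_zero_iff (two_ne_zero) |>.mp (le_antisymm this (sq_nonneg _)))
  refine hψ ?_
  rw [← hRf, hT]
  change (star T) (T f) = 0
  rw [h0, map_zero]

end Abstract

/-! ### Real and complex functions in the domain -/

section Complexification

variable {d n : ℕ}

/-- Real and imaginary parts of an element of the domain are in the domain, as the potential and
the test functions are real. -/
theorem IsImage.isRealImage {ψ f : State d n} (h : IsImage ψ f) (L : ℂ →L[ℝ] ℝ) :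
    IsRealImage (fun x => L (ψ x)) (fun x => L (f x)) := by
  obtain ⟨h1, h2, h3⟩ := h
  have hL : ∀ {η : Config d n → ℝ} {F : Config d n → ℂ}, Continuous η → HasCompactSupport η →
      LocallyIntegrable F → ∫ x, η x * L (F x) = L (∫ x, η x • F x) := by
    intro η F hη hc hF
    rw [← L.integral_comp_comm (integrable_test_smul hη hc hF)]
    simp only [map_smul, smul_eq_mul]
  refine ⟨L.comp_memLp' (Lp.memLp ψ), L.comp_memLp' (Lp.memLp f), fun u => ?_, fun η hη hc => ?_⟩
  · obtain ⟨g, hg⟩ := h1 u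
    refine ⟨fun x => L (g x), L.comp_memLp' (Lp.memLp g), fun η hη hc => ?_⟩
    rw [hL hη.continuous hc (locallyIntegrable_state g),
      hL (contDiff_lineDeriv hη u).continuous (hasCompactSupport_lineDeriv hη hc u)
        (locallyIntegrable_state ψ), hg η hη hc, map_neg]
  · have hV : ∀ x, potential x * L (ψ x) = L (potential x • ψ x) := fun x => by
      rw [map_smul, smul_eq_mul]
    simp only [hV]
    rw [hL hη.continuous hc (locallyIntegrable_state f), hL (continuous_kinetic hη)
      (hasCompactSupport_kinetic hc) (locallyIntegrable_state ψ), hL hη.continuous hc h2,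
      h3 η hη hc, map_add]

/-- The Hamiltonian is symmetric on complex functions. -/
theorem IsImage.inner_eq (hd : 2 ≤ d) {φ f ψ g : State d n} (h : IsImage φ f)
    (h' : IsImage ψ g) : (inner ℂ f ψ : ℂ) = inner ℂ φ g := by
  have key : ∀ L L' : ℂ →L[ℝ] ℝ, ∫ x, L (φ x) * L' (g x) = ∫ x, L (f x) * L' (ψ x) :=
    fun L L' => (h.isRealImage L).symm hd (h'.isRealImage L')
  have hint : ∀ (L L' : ℂ →L[ℝ] ℝ) (a b : State d n), Integrable fun x => L (a x) * L' (b x) :=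
    fun L L' a b => (L.comp_memLp' (Lp.memLp a)).integrable_mul (L'.comp_memLp' (Lp.memLp b))
  have hre : ∀ a b : State d n, (inner ℂ a b : ℂ).re =
      (∫ x, Complex.reCLM (a x) * Complex.reCLM (b x)) +
        ∫ x, Complex.imCLM (a x) * Complex.imCLM (b x) := by
    intro a b
    rw [L2.inner_def, ← integral_add (hint _ _ a b) (hint _ _ a b)]
    refine (Complex.reCLM.integral_comp_comm (L2.integrable_inner a b)).symm.trans ?_
    refine integral_congr_ae (ae_of_all _ fun x => ?_)
    simp [Complex.mul_re]
    ring
  have him : ∀ a b : State d n, (inner ℂ a b : ℂ).im =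
      (∫ x, Complex.reCLM (a x) * Complex.imCLM (b x)) -
        ∫ x, Complex.imCLM (a x) * Complex.reCLM (b x) := by
    intro a b
    rw [L2.inner_def, ← integral_sub (hint _ _ a b) (hint _ _ a b)]
    refine (Complex.imCLM.integral_comp_comm (L2.integrable_inner a b)).symm.trans ?_
    refine integral_congr_ae (ae_of_all _ fun x => ?_)
    simp [Complex.mul_im]
    ring
  refine Complex.ext ?_ ?_
  · rw [hre, hre, key, key]
  · rw [him, him, key, key]

theorem memLp_complex_ofReal {φ : Config d n → ℝ} (h : MemLp φ 2) :
    MemLp (fun x => (φ x : ℂ)) 2 := Complex.ofRealCLM.comp_memLp' h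

theorem IsRealImage.isImage {φ f : Config d n → ℝ} (h : IsRealImage φ f)
    (hV : LocallyIntegrable fun x => potential x * φ x) :
    IsImage ((memLp_complex_ofReal h.memLp).toLp _)
      ((memLp_complex_ofReal h.memLp_image).toLp _) := by
  have hL : ∀ (η : Config d n → ℝ) {F : Config d n → ℝ} {G : Config d n → ℂ},
      G =ᵐ[volume] (fun x => (F x : ℂ)) → ∫ x, η x • G x = ((∫ x, η x * F x : ℝ) : ℂ) := by
    intro η F G hG
    rw [← integral_complex_ofReal]
    refine integral_congr_ae ?_
    filter_upwards [hG] with x hx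
    rw [hx]; simp
  have hφ := (memLp_complex_ofReal h.memLp).coeFn_toLp
  have hf := (memLp_complex_ofReal h.memLp_image).coeFn_toLp
  have hVφ : (fun x => potential x • (memLp_complex_ofReal h.memLp).toLp _ x) =ᵐ[volume]
      fun x => ((potential x * φ x : ℝ) : ℂ) := by
    filter_upwards [hφ] with x hx
    rw [hx]; simp
  refine ⟨fun u => ?_, ?_, fun η hη hc => ?_⟩
  · obtain ⟨g, hg, hgw⟩ := h.weakDeriv u
    refine ⟨(memLp_complex_ofReal hg).toLp _, fun η hη hc => ?_⟩
    rw [hL η (memLp_complex_ofReal hg).coeFn_toLp, hL _ hφ, hgw η hη hc, Complex.ofReal_neg]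
  · refine LocallyIntegrable.congr (fun x => ?_) hVφ.symm
    obtain ⟨U, hU, hi⟩ := hV x
    exact ⟨U, hU, hi.ofReal⟩
  · rw [hL η hf, hL _ hφ, hL η hVφ, h.eq η hη hc, Complex.ofReal_add]

end Complexification

/-! ### The energy bound -/

section Energy

variable {d n : ℕ}

theorem hamiltonian_isImage (ψ : (hamiltonian d n).domain) :
    IsImage (ψ : State d n) (hamiltonian d n ψ) :=
  (mem_graph_hamiltonian ((ψ : State d n), hamiltonian d n ψ)).mp (LinearPMap.mem_graph _ ψ)

theorem re_inner_toLp_ofReal {a b : Config d n → ℝ} (ha : MemLp a 2) (hb : MemLp b 2) :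
    (inner ℂ ((memLp_complex_ofReal ha).toLp _) ((memLp_complex_ofReal hb).toLp _) : ℂ).re =
      ∫ x, a x * b x := by
  rw [L2.inner_def]
  refine (Complex.reCLM.integral_comp_comm (L2.integrable_inner _ _)).symm.trans ?_
  refine integral_congr_ae ?_
  filter_upwards [(memLp_complex_ofReal ha).coeFn_toLp, (memLp_complex_ofReal hb).coeFn_toLp]
    with x hx hx'
  rw [hx, hx']
  simp [mul_comm]

/-- The expectation value of the energy in the trial function is at most `B`, whence a point of the
spectrum at most `B`. -/
theorem exists_energy_le (hd : 2 ≤ d) {c B : ℝ} (hc : c * ((d : ℝ) - 1) = 1)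
    (hB : ∀ᵐ x : Config d n, trialEnergy c x ≤ B) :
    ∃ e ∈ energySpectrum d n, e ≤ B := by
  have h := isRealImage_trial (n := n) hd hc
  have hV : LocallyIntegrable fun x : Config d n => potential x * trial c 0 x := by
    have := (locallyIntegrable_potential (n := n) hd).smul_continuous (continuous_trial c 0)
    exact this
  have him := h.isImage hV
  obtain ⟨ψ, hψ, hψ'⟩ := (LinearPMap.mem_graph_iff _).mp ((mem_graph_hamiltonian
    (((memLp_complex_ofReal h.memLp).toLp _), (memLp_complex_ofReal h.memLp_image).toLp _)).mpr him)
  have hψ0 : (ψ : State d n) ≠ 0 := by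
    rw [hψ]
    intro h0
    have h1 := Lp.eq_zero_iff_ae_eq_zero.mp h0
    have h2 : ∀ᵐ _ : Config d n, False := by
      filter_upwards [h1, (memLp_complex_ofReal h.memLp).coeFn_toLp] with x hx hx'
      rw [hx'] at hx
      exact (trial_pos c 0 x).ne' (Complex.ofReal_eq_zero.mp hx)
    simpa using h2.exists
  have hψB : (inner ℂ (ψ : State d n) (hamiltonian d n ψ) : ℂ).re ≤
      B * ‖(ψ : State d n)‖ ^ 2 := by
    have hn : ‖(ψ : State d n)‖ ^ 2 = ∫ x : Config d n, trial c 0 x * trial c 0 x := by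
      rw [hψ, ← re_inner_toLp_ofReal h.memLp h.memLp, inner_self_eq_norm_sq_to_K]
      norm_cast
    rw [hn, hψ, hψ', re_inner_toLp_ofReal h.memLp h.memLp_image, ← integral_const_mul]
    refine integral_mono_ae (h.memLp.integrable_mul h.memLp_image)
      ((h.memLp.integrable_mul h.memLp).const_mul B) ?_
    filter_upwards [hB] with x hx
    change trial c 0 x * (trialEnergy c x * trial c 0 x) ≤ B * (trial c 0 x * trial c 0 x)
    nlinarith [mul_le_mul_of_nonneg_right hx (mul_self_nonneg (trial c 0 x))]
  obtain ⟨e, he, he'⟩ := exists_le_not_isResolventPoint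
    (fun φ ψ => (hamiltonian_isImage φ).inner_eq hd (hamiltonian_isImage ψ)) hψ0 hψB
  exact ⟨e, he', he⟩

/-- Pairing a non-negative eigenfunction with the trial function shows that its energy is a
weighted mean of the local energy. -/
theorem IsNonnegEigenvalue.le (hd : 2 ≤ d) {c B : ℝ} (hc : c * ((d : ℝ) - 1) = 1)
    (hB : ∀ᵐ x : Config d n, trialEnergy c x ≤ B) {e : ℝ} (he : IsNonnegEigenvalue d n e) :
    e ≤ B := by
  obtain ⟨Φ, hΦ, hpos, heig⟩ := he
  by_contra! hlt
  have h := isRealImage_trial (n := n) hd hc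
  have him := hamiltonian_isImage Φ
  rw [heig] at him
  have hR := him.isRealImage Complex.reCLM
  have hsymm := hR.symm hd h
  have hre : (fun x => Complex.reCLM (((e : ℂ) • (Φ : State d n) : State d n) x)) =ᵐ[volume]
      fun x => e * ((Φ : State d n) x).re := by
    filter_upwards [Lp.coeFn_smul (e : ℂ) (Φ : State d n)] with x hx
    rw [hx]
    simp
  have i1 := hR.memLp.integrable_mul h.memLp_image
  have i2 := hR.memLp_image.integrable_mul h.memLp
  have h0 : ∫ x, (e - trialEnergy c x) * (((Φ : State d n) x).re * trial c 0 x) = 0 := by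
    refine (Eq.trans (integral_congr_ae ?_) (integral_sub i2 i1)).trans
      (sub_eq_zero_of_eq hsymm.symm)
    filter_upwards [hre] with x hx
    change _ = Complex.reCLM (((e : ℂ) • (Φ : State d n) : State d n) x) * trial c 0 x -
      ((Φ : State d n) x).re * (trialEnergy c x * trial c 0 x)
    rw [hx]
    ring
  have hi : Integrable fun x => (e - trialEnergy c x) * (((Φ : State d n) x).re * trial c 0 x) := by
    refine (i2.sub i1).congr ?_
    filter_upwards [hre] with x hx
    change Complex.reCLM (((e : ℂ) • (Φ : State d n) : State d n) x) * trial c 0 x -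
      ((Φ : State d n) x).re * (trialEnergy c x * trial c 0 x) = _
    rw [hx]
    ring
  rw [integral_eq_zero_iff_of_nonneg_ae _ hi] at h0
  · refine hΦ (Lp.eq_zero_iff_ae_eq_zero.mpr ?_)
    filter_upwards [h0, hB, hpos] with x hx hx' hp
    have h1 : 0 < e - trialEnergy c x := by linarith
    have h2 : ((Φ : State d n) x).re = 0 := by
      simpa [h1.ne', (trial_pos c 0 x).ne'] using hx
    exact Complex.ext h2 hp.2
  · filter_upwards [hB, hpos] with x hx hp
    exact mul_nonneg (by linarith) (mul_nonneg hp.1 (trial_pos c 0 x).le)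

end Energy

end ManyBody

theorem mainTheorem3 (d N : ℕ) (hd : 2 ≤ d) (hN : 2 ≤ N) :
    (∃ E ∈ ManyBody.energySpectrum d (N - 1),
      E ≤ -((N : ℝ) * ((N : ℝ) - 1) * ((N : ℝ) + 1) / (6 * ((d : ℝ) - 1) ^ 2))) ∧
    (∀ e₀ : ℝ, IsGLB (ManyBody.energySpectrum d (N - 1)) e₀ →
      e₀ ≤ -((N : ℝ) * ((N : ℝ) - 1) * ((N : ℝ) + 1) / (6 * ((d : ℝ) - 1) ^ 2))) ∧
    (∀ e₀ : ℝ, ManyBody.IsNonnegEigenvalue d (N - 1) e₀ →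
      e₀ ≤ -((N : ℝ) * ((N : ℝ) - 1) * ((N : ℝ) + 1) / (6 * ((d : ℝ) - 1) ^ 2))) := by
  have hd1 : (d : ℝ) - 1 ≠ 0 := by
    have : (2 : ℝ) ≤ d := by exact_mod_cast hd
    linarith
  have hc : ((d : ℝ) - 1)⁻¹ * ((d : ℝ) - 1) = 1 := inv_mul_cancel₀ hd1
  have hB : ∀ᵐ x : ManyBody.Config d (N - 1), ManyBody.trialEnergy ((d : ℝ) - 1)⁻¹ x ≤
      -((N : ℝ) * ((N : ℝ) - 1) * ((N : ℝ) + 1) / (6 * ((d : ℝ) - 1) ^ 2)) := by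
    filter_upwards [ManyBody.ae_forall_sep_ne_zero (n := N - 1) (by omega : 0 < d)] with x hx
    refine (ManyBody.trialEnergy_le _ hx).trans (le_of_eq ?_)
    have h1 : ((N - 1 : ℕ) : ℝ) + 1 = N := by
      rw [Nat.cast_sub (by omega)]; push_cast; ring
    rw [h1]
    field_simp
    ring
  obtain ⟨E, hE, hEB⟩ := ManyBody.exists_energy_le hd hc hB
  exact ⟨⟨E, hE, hEB⟩, fun e₀ h => (h.1 hE).trans hEB, fun e₀ h => h.le hd hc hB⟩
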